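/- Let $\Gamma$ be the set of dyadic rationals in $(0,1)$; each $a\in\Gamma$ is written in reduced form $a=p/2^{l}$ with $p$ odd. An address is a finite (possibly empty) sequence $w=(n_1,a_1,\dots,n_k,a_k)$ with $n_i\in\{0,1,2,\dots\}$, $a_i\in\Gamma$; its length is $k$. Consider systems of stars in $\mathbb R^2$, one star $S_w=\bigcup_{n\ge 0}B_{w,n}$ for each address $w$. The beams $B_{w,n}$ are nondegenerate segments with one end point at the centre $c_w$ of $S_w$, distinct beams of $S_w$ meet only in $c_w$, and $\operatorname{diam}B_{w,n}\to0$ as $n\to\infty$. Write $(w,n,r)$, $0<r\le 1$, for the point of $B_{w,n}$ at distance $r\cdot\operatorname{length}(B_{w,n})$ from $c_w$. The centre of the star of the empty address is the origin $\mathbf 0$, and the centre of $S_{(w,n,a)}$ is the point $(w,n,a)$. The beams $B_n$ of the star of the empty address satisfy $B_0=[-1,0]\times\{0\}$, $B_1=\{0\}\times[0,1]$, and for $n\ge2$, $B_n$ lies in the closed first quadrant and its slope $m_n$ satisfies $0<m_{n+1}<m_n$, $m_n\to0$. Let $D_k$ be the union of the stars $S_w$ with $w$ of length less than $k$, let $D_\infty=\overline{\bigcup_k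 D_k}$ (the planar model of Wa\.zewski's universal dendrite), and let the branch $E_w$ be the closure of the union of all stars $S_{w'}$ such that $w$ is an initial segment of $w'$. Call the system admissible if, moreover, $E_w\cap D_k=\{c_w\}$ for every address $w$ of length $k\ge1$, $E_v\cap E_w=\emptyset$ for distinct addresses $v,w$ of equal length, and for each $\varepsilon>0$ all but finitely many addresses $w$ satisfy $\operatorname{diam}E_w<\varepsilon$. Then admissible systems exist, and for each of them there is exactly one continuous map $f:D_\infty\to D_\infty$ with $f(\mathbf 0)=\mathbf 0$ that acts on $\bigcup_k D_k$ by $$(0,r)\mapsto \mathbf 0,\qquad (n,\ldots)\mapsto(n-1,\ldots)\ \ (n\ge1),\qquad (0,a,m,\ldots)\mapsto(m+l,\ldots)\ \ (a=p/2^{l},\ p\text{ odd}),$$ where the entries indicated by dots are unchanged. This map $f$ is transitive: for all non-empty open sets $U,V\subseteq D_\infty$ there is an integer $n\ge1$ with $f^{n}(U)\cap V\ne\emptyset$. -/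

import Mathlib

open Set Filter Topology

namespace UniversalDendrite

/-- The Euclidean plane. -/
abbrev Plane : Type := EuclideanSpace ℝ (Fin 2)

/-- A dyadic rational of the open interval `(0,1)`, in its reduced form `num / 2 ^ exp` with `num` odd.
(The exponent is automatically positive.) -/
structure Dyadic where
  num : ℕ
  exp : ℕ
  odd_num : Odd num
  num_lt : num < 2 ^ exp

/-- The value `num / 2 ^ exp` of a dyadic. -/
noncomputable def Dyadic.val (a : Dyadic) : ℝ := (a.num : ℝ) / 2 ^ a.exp

/-- An address `(n₁, a₁), …, (n_k, a_k)`: go along the beam `n₁` of the first star up to the proportion `a₁` of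
its length, there along the beam `n₂` of the star with this centre up to the proportion `a₂`, and so on. -/
abbrev Address : Type := List (ℕ × Dyadic)

/-- A system of stars in the plane, one for each address. The star at the address `w` has the centre `center w`,
and its beams are the segments from `center w` to `tip w n`, for `n = 0, 1, 2, …`. The first star is centred at the
origin, and the star at the address `w ++ [(n, a)]` is centred at the point of proportion `a` on the beam `n` of
the star at `w`. -/
structure StarSystem where
  center : Address → Plane
  tip : Address → ℕ → Plane
  center_nil : center [] = 0
  center_append : ∀ (w : Address) (n : ℕ) (a : Dyadic),
    center (w ++ [(n, a)]) = AffineMap.lineMap (center w) (tip w n) a.val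

namespace StarSystem

variable (C : StarSystem)

/-- The point with itinerary `(w, n, r)`: it lies on the beam `n` of the star at `w`, and its distance from the
centre of that star is `r` times the length of the beam. -/
noncomputable def point (w : Address) (n : ℕ) (r : ℝ) : Plane :=
  AffineMap.lineMap (C.center w) (C.tip w n) r

/-- The beam `n` of the star at the address `w`. -/
def beam (w : Address) (n : ℕ) : Set Plane := segment ℝ (C.center w) (C.tip w n)

/-- The star at the address `w`. -/
def star (w : Address) : Set Plane := ⋃ n : ℕ, C.beam w n

/-- The union `D_k` of the stars of the first `k` steps of the construction: `D_1` is the first star, and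
`D_{k+1}` is `D_k` together with the stars at the addresses of length `k`. -/
def D (k : ℕ) : Set Plane := ⋃ (w : Address) (_ : w.length < k), C.star w

/-- `D_∞`, the closure of the union of the `D_k`. -/
def Dinf : Set Plane := closure (⋃ k : ℕ, C.D k)

/-- The branch at the address `w`: the closure of the union of the star at `w` and of all later stars that grow,
directly or indirectly, from it. -/
def branch (w : Address) : Set Plane := closure (⋃ u : Address, C.star (w ++ u))

/-- The slope of the beam `n` of the first star. -/
noncomputable def slope (n : ℕ) : ℝ := C.tip [] n 1 / C.tip [] n 0

/-- The requirements on the choice of the stars.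

As `star w ⊆ branch w`, the last three fields contain the requirements that a new star meets what has been built
before in its centre only, that distinct stars of one step are disjoint, and that their diameters tend to `0` when
some index tends to infinity. They are imposed on the whole branches, so that the closure in `Dinf` creates no
new intersections. -/
structure IsAdmissible : Prop where
  /-- The beams are arcs. -/
  tip_ne_center : ∀ (w : Address) (n : ℕ), C.tip w n ≠ C.center w
  /-- Distinct beams of a star meet in the centre only. -/
  beam_inter_beam : ∀ (w : Address) (m n : ℕ), m ≠ n → C.beam w m ∩ C.beam w n = {C.center w}
  /-- The diameters of the beams of a star tend to `0`. -/
  tendsto_diam_beam : ∀ w : Address, Tendsto (fun n : ℕ => Metric.ediam (C.beam w n)) atTop (𝓝 0)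
  /-- The beam `0` of the first star is `[-1,0] × {0}`. -/
  tip_nil_zero : C.tip [] 0 = !₂[-1, 0]
  /-- The beam `1` of the first star is `{0} × [0,1]`. -/
  tip_nil_one : C.tip [] 1 = !₂[0, 1]
  /-- The other beams of the first star lie in the first quadrant. -/
  beam_nil_subset : ∀ n : ℕ, 2 ≤ n → C.beam [] n ⊆ {p | 0 ≤ p 0 ∧ 0 ≤ p 1}
  slope_pos : ∀ n : ℕ, 2 ≤ n → 0 < C.slope n
  slope_succ_lt : ∀ n : ℕ, 2 ≤ n → C.slope (n + 1) < C.slope n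
  tendsto_slope : Tendsto C.slope atTop (𝓝 0)
  /-- A branch meets the stars of the earlier steps in its first centre only. -/
  branch_inter_D : ∀ w : Address, w ≠ [] → C.branch w ∩ C.D w.length = {C.center w}
  /-- Distinct branches that start at the same step are disjoint. -/
  disjoint_branch : ∀ v w : Address, v.length = w.length → v ≠ w → Disjoint (C.branch v) (C.branch w)
  /-- For each `ε > 0`, all but finitely many branches have a diameter less than `ε`. -/
  tendsto_diam_branch : Tendsto (fun w : Address => Metric.ediam (C.branch w)) cofinite (𝓝 0)

/-- The action of the map `f` on the points of `⋃ k, D_k`, in terms of itineraries. -/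
structure ActsOnItineraries (f : C.Dinf → C.Dinf) : Prop where
  /-- `(0) → (0)` -/
  origin : ∀ x : C.Dinf, (x : Plane) = 0 → (f x : Plane) = 0
  /-- `(0, r) → (0)`: the beam `0` of the first star is collapsed to the origin. -/
  beam_zero : ∀ (r : ℝ), r ∈ Ioc (0 : ℝ) 1 → ∀ x : C.Dinf,
    (x : Plane) = C.point [] 0 r → (f x : Plane) = 0
  /-- `(n + 1, r) → (n, r)` -/
  beam_succ : ∀ (n : ℕ) (r : ℝ), r ∈ Ioc (0 : ℝ) 1 → ∀ x : C.Dinf,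
    (x : Plane) = C.point [] (n + 1) r → (f x : Plane) = C.point [] n r
  /-- `(n + 1, a, …, m, r) → (n, a, …, m, r)` -/
  star_succ : ∀ (n : ℕ) (a : Dyadic) (w : Address) (m : ℕ) (r : ℝ), r ∈ Ioc (0 : ℝ) 1 → ∀ x : C.Dinf,
    (x : Plane) = C.point ((n + 1, a) :: w) m r → (f x : Plane) = C.point ((n, a) :: w) m r
  /-- `(0, a, m, r) → (m + l, r)` for `a = p / 2 ^ l` with `p` odd -/
  star_zero : ∀ (a : Dyadic) (m : ℕ) (r : ℝ), r ∈ Ioc (0 : ℝ) 1 → ∀ x : C.Dinf,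
    (x : Plane) = C.point [(0, a)] m r → (f x : Plane) = C.point [] (m + a.exp) r
  /-- `(0, a, m, b, …, n, r) → (m + l, b, …, n, r)` for `a = p / 2 ^ l` with `p` odd -/
  star_zero_cons : ∀ (a : Dyadic) (m : ℕ) (b : Dyadic) (w : Address) (n : ℕ) (r : ℝ),
    r ∈ Ioc (0 : ℝ) 1 → ∀ x : C.Dinf,
    (x : Plane) = C.point ((0, a) :: (m, b) :: w) n r →
      (f x : Plane) = C.point ((m + a.exp, b) :: w) n r

end StarSystem

/-- A self-map `f` is transitive if for all non-empty open sets `U` and `V` some iterate `f^n` with `n ≥ 1`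
satisfies `f^n(U) ∩ V ≠ ∅`. -/
def IsTransitiveMap {X : Type*} [TopologicalSpace X] (f : X → X) : Prop :=
  ∀ U V : Set X, IsOpen U → IsOpen V → U.Nonempty → V.Nonempty →
    ∃ n : ℕ, 1 ≤ n ∧ ((f^[n] '' U) ∩ V).Nonempty

end UniversalDendrite

/-! Transitivity is combinatorial. On centres of stars the map acts through `shiftAddress`. Branches
shrink to points and dyadics are dense on each beam, so every non-empty open set contains a whole
branch (`exists_branch_subset`). Iterating `shiftAddress` consumes an address letter by letter:
after `n + 1` steps the letter `(n, a)` is gone and the next index has grown by `a.exp`. By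
induction on the length, each non-empty `w` has an extension `w ++ u` that reaches a prescribed
non-empty `v` after finitely many steps (`exists_iterate_shiftAddress_eq`). Hence some centre in the
branch at `w` is sent to the centre at `v`.

The map is unique because the itinerary rules fix it on the stars, which are dense. For existence,
itineraries are unique (`point_eq_iff`), so the rules define a map on the union of the stars. Its
continuity rests on a gluing principle: continuity survives the attachment of a null family of sets
whose images also form a null family (`continuousWithinAt_union_iUnion_of_null`). Images stay small
because `shiftAddress` is finite-to-one over non-empty addresses and, from length two on, carries
branches into branches. The addresses `[(0, a)]`, which all go to `[]`, are controlled separately: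
the star there lands in the beams of index at least `a.exp`. A point of `Dinf` on no star lies in
branches of every depth, each a neighbourhood relative to the stars, with images of diameter tending
to zero; completeness then extends the map (`exists_tendsto_itineraryMap`).

Admissible systems are built in the complex plane. All branches except the root are similar copies
of subsets of one truncated cone, erected with its apex on a beam and its axis perpendicular to it.
The sizes are chosen so that cones on one beam are disjoint (`place_ne`) and everything attached to
a beam stays in a thin sector, hence in pairwise disjoint regions (`rootTip_mul_mem_region`).
Products of contraction ratios tend to zero along addresses (`finite_prod_ratio_ge`), which makes
the branches a null family. -/

namespace UniversalDendrite

/-! ### Separation and density of dyadic rationals -/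

namespace Dyadic

theorem val_pos (a : Dyadic) : 0 < a.val := by
  have := a.odd_num.pos
  unfold val
  positivity

theorem val_lt_one (a : Dyadic) : a.val < 1 := by
  unfold val
  rw [div_lt_one (by positivity)]
  exact_mod_cast a.num_lt

theorem val_mem (a : Dyadic) : a.val ∈ Ioc (0 : ℝ) 1 := ⟨a.val_pos, a.val_lt_one.le⟩

theorem val_mem_Icc (a : Dyadic) : a.val ∈ Icc (0 : ℝ) 1 := ⟨a.val_pos.le, a.val_lt_one.le⟩

theorem exp_pos (a : Dyadic) : 0 < a.exp := by
  rcases Nat.eq_zero_or_pos a.exp with h | h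
  · have h1 := a.num_lt
    have h2 := a.odd_num.pos
    rw [h] at h1
    omega
  · exact h

theorem ext' {a b : Dyadic} (h : a.num = b.num) (h' : a.exp = b.exp) : a = b := by
  cases a; cases b; simp_all

/-- Parity: over the common denominator, a strictly smaller exponent makes the left numerator even,
while `b.num` is odd. -/
theorem num_mul_ne (a b : Dyadic) (hne : a ≠ b) (h : a.exp ≤ b.exp) :
    a.num * 2 ^ (b.exp - a.exp) ≠ b.num := by
  intro heq
  rcases h.eq_or_lt with h | h
  · apply hne
    rw [h] at heq
    exact Dyadic.ext' (by simpa using heq) h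
  · have h1 : Even (a.num * 2 ^ (b.exp - a.exp)) :=
      (Nat.even_pow.2 ⟨even_two, by omega⟩).mul_left _
    rw [heq] at h1
    exact (Nat.not_even_iff_odd.2 b.odd_num) h1

/-- Distinct dyadics are at least `2 ^ (-m)` apart, where `m` is the larger one of their exponents. -/
theorem one_le_abs_sub_mul (a b : Dyadic) (hne : a ≠ b) (h : a.exp ≤ b.exp) :
    1 ≤ |a.val - b.val| * 2 ^ b.exp := by
  have h2 : (2 : ℝ) ^ b.exp = 2 ^ a.exp * 2 ^ (b.exp - a.exp) := by
    rw [← pow_add]; congr 1; omega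
  have h1 : (a.val - b.val) * 2 ^ b.exp
      = ((a.num * 2 ^ (b.exp - a.exp) : ℕ) : ℤ) - (b.num : ℤ) := by
    unfold val
    rw [sub_mul, div_mul_cancel₀ _ (by positivity), h2]
    push_cast
    field_simp
  have h3 : |a.val - b.val| * 2 ^ b.exp = |(a.val - b.val) * 2 ^ b.exp| := by
    rw [abs_mul, abs_of_pos (by positivity : (0 : ℝ) < 2 ^ b.exp)]
  rw [h3, h1]
  have h4 : ((a.num * 2 ^ (b.exp - a.exp) : ℕ) : ℤ) - (b.num : ℤ) ≠ 0 := by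
    have := num_mul_ne a b hne h
    omega
  exact_mod_cast Int.one_le_abs h4

theorem finite_exp_le (m : ℕ) : {a : Dyadic | a.exp ≤ m}.Finite := by
  have : ((fun a : Dyadic => (a.num, a.exp)) '' {a : Dyadic | a.exp ≤ m}).Finite := by
    refine ((Set.finite_Iio (2 ^ m)).prod (Set.finite_Iic m)).subset ?_
    rintro _ ⟨a, ha, rfl⟩
    exact ⟨a.num_lt.trans_le (Nat.pow_le_pow_right (by norm_num) ha), ha⟩
  refine Set.Finite.of_finite_image this ?_
  intro a _ b _ h
  simp only [Prod.mk.injEq] at h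
  exact Dyadic.ext' h.1 h.2

/-- Every interval in `[0,1]` contains infinitely many dyadics. -/
theorem infinite_between {x y : ℝ} (hx : 0 ≤ x) (hxy : x < y) (hy : y ≤ 1) :
    {a : Dyadic | x < a.val ∧ a.val < y}.Infinite := by
  have key : ∀ l : ℕ, 2 < (y - x) * 2 ^ l →
      ∃ a : Dyadic, a.exp = l ∧ x < a.val ∧ a.val < y := by
    intro l hl
    have hp : (0 : ℝ) < 2 ^ l := by positivity
    -- With this choice `2 * k + 1` is the least odd natural number above `x * 2 ^ l`. It exceeds it
    -- by at most 2, so it stays below `y * 2 ^ l`.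
    set k := ⌊(x * 2 ^ l + 1) / 2⌋₊ with hk
    have hx0 : 0 ≤ (x * 2 ^ l + 1) / 2 := by positivity
    have h1 : (k : ℝ) ≤ (x * 2 ^ l + 1) / 2 := Nat.floor_le hx0
    have h2 : (x * 2 ^ l + 1) / 2 < k + 1 := Nat.lt_floor_add_one _
    have h3 : ((2 * k + 1 : ℕ) : ℝ) < y * 2 ^ l := by
      push_cast; nlinarith
    have h4 : x * 2 ^ l < ((2 * k + 1 : ℕ) : ℝ) := by
      push_cast; linarith
    have h5 : 2 * k + 1 < 2 ^ l := by
      have : ((2 * k + 1 : ℕ) : ℝ) < ((2 ^ l : ℕ) : ℝ) := by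
        push_cast at h3 ⊢; nlinarith
      exact_mod_cast this
    refine ⟨⟨2 * k + 1, l, ⟨k, rfl⟩, h5⟩, rfl, ?_, ?_⟩
    · unfold val; rwa [lt_div_iff₀ hp]
    · unfold val; rwa [div_lt_iff₀ hp]
  obtain ⟨N, hN⟩ := pow_unbounded_of_one_lt (2 / (y - x)) (one_lt_two : (1 : ℝ) < 2)
  have hN' : ∀ l ≥ N, 2 < (y - x) * 2 ^ l := by
    intro l hl
    have h1 : (2 : ℝ) ^ N ≤ 2 ^ l := pow_le_pow_right₀ (by norm_num) hl
    have := sub_pos.2 hxy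
    rw [div_lt_iff₀ this] at hN
    nlinarith
  intro hfin
  have : (Dyadic.exp '' {a : Dyadic | x < a.val ∧ a.val < y}).Finite := hfin.image _
  refine (Set.Ici_infinite N) (this.subset ?_)
  intro l hl
  obtain ⟨a, ha, h⟩ := key l (hN' l hl)
  exact ⟨a, h, ha⟩

end Dyadic

/-! ### Dynamics on addresses -/

/-- The action of the map on the addresses of the centres. -/
def shiftAddress : Address → Address
  | [] => []
  | (n + 1, a) :: w => (n, a) :: w
  | [(0, _)] => []
  | (0, a) :: (m, b) :: w => (m + a.exp, b) :: w

/-- The rule looks at no more than the first two letters. Length one is not enough: on `[(0, a)]`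
the outcome depends on the letter that follows. -/
theorem shiftAddress_append {w : Address} (hw : 2 ≤ w.length) (u : Address) :
    shiftAddress (w ++ u) = shiftAddress w ++ u := by
  match w, hw with
  | (0, a) :: (m, b) :: w, _ => rfl
  | (n + 1, a) :: (m, b) :: w, _ => rfl

theorem length_le_shiftAddress (w : Address) : w.length ≤ (shiftAddress w).length + 1 := by
  match w with
  | [] => simp
  | (n + 1, a) :: w => simp [shiftAddress]
  | [(0, a)] => simp [shiftAddress]
  | (0, a) :: (m, b) :: w => simp [shiftAddress]

theorem iterate_shiftAddress_cons (k n : ℕ) (a : Dyadic) (w : Address) :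
    shiftAddress^[k] ((n + k, a) :: w) = (n, a) :: w := by
  induction k with
  | zero => rfl
  | succ k ih => rw [Function.iterate_succ_apply]; exact ih

theorem iterate_shiftAddress_cons_cons (n : ℕ) (a : Dyadic) (m : ℕ) (b : Dyadic) (w : Address) :
    shiftAddress^[n + 1] ((n, a) :: (m, b) :: w) = (m + a.exp, b) :: w := by
  have := iterate_shiftAddress_cons n 0 a ((m, b) :: w)
  rw [zero_add] at this
  rw [Function.iterate_succ_apply', this]
  rfl

/-- Each round of `n + 1` steps removes the first letter and only changes the index of the second,
so the length drops until one letter is left. Then `v` itself is the right extension: removing the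
last letter raises the first index of `v` by `a.exp`, and `a.exp` further steps lower it again. -/
theorem exists_iterate_shiftAddress_eq (v : Address) (hv : v ≠ []) (w : Address) (hw : w ≠ []) :
    ∃ (u : Address) (k : ℕ), 1 ≤ k ∧ shiftAddress^[k] (w ++ u) = v := by
  obtain ⟨⟨m, b⟩, v, rfl⟩ := List.exists_cons_of_ne_nil hv
  induction hN : w.length generalizing w with
  | zero => exact absurd (List.length_eq_zero_iff.1 hN) hw
  | succ N ih =>
    match w, hw, hN with
    | [(n, a)], _, _ =>
      refine ⟨(m, b) :: v, a.exp + (n + 1), by omega, ?_⟩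
      rw [Function.iterate_add_apply]
      have := iterate_shiftAddress_cons_cons n a m b v
      rw [show [(n, a)] ++ (m, b) :: v = (n, a) :: (m, b) :: v from rfl, this,
        iterate_shiftAddress_cons]
    | (n, a) :: (m', b') :: w, _, hN =>
      obtain ⟨u, k, hk, h⟩ := ih ((m' + a.exp, b') :: w) (by simp) (by simpa using hN)
      refine ⟨u, k + (n + 1), by omega, ?_⟩
      rw [Function.iterate_add_apply, ← h]
      congr 1
      exact iterate_shiftAddress_cons_cons n a m' b' (w ++ u)

/-- A preimage either raises the first index `m` by one or inserts a letter `(0, a)` with `a.exp ≤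
m`, and only finitely many dyadics have bounded exponent. For `v = []` this fails, as every `[(0,
a)]` is a preimage. -/
theorem finite_shiftAddress_eq (v : Address) (hv : v ≠ []) :
    {w : Address | shiftAddress w = v}.Finite := by
  obtain ⟨⟨m, b⟩, v, rfl⟩ := List.exists_cons_of_ne_nil hv
  refine (((Dyadic.finite_exp_le m).image
    (fun a : Dyadic => (0, a) :: (m - a.exp, b) :: v)).union
      (Set.finite_singleton ((m + 1, b) :: v))).subset ?_
  intro w hw
  rw [mem_ofPred_eq] at hw
  match w, hw with
  | (n + 1, a) :: w, hw =>
    right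
    simp only [shiftAddress, List.cons.injEq, Prod.mk.injEq] at hw
    obtain ⟨⟨rfl, rfl⟩, rfl⟩ := hw
    rfl
  | (0, a) :: (m', b') :: w, hw =>
    left
    simp only [shiftAddress, List.cons.injEq, Prod.mk.injEq] at hw
    obtain ⟨⟨rfl, rfl⟩, rfl⟩ := hw
    exact ⟨a, by simp, by simp⟩

/-! ### Itineraries of points and transitivity -/

namespace StarSystem

variable (C : StarSystem)

/-- The union of all stars. -/
def stars : Set Plane := ⋃ k : ℕ, C.D k

theorem point_zero (w : Address) (n : ℕ) : C.point w n 0 = C.center w := by simp [point]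

theorem point_val (w : Address) (n : ℕ) (a : Dyadic) :
    C.point w n a.val = C.center (w ++ [(n, a)]) := (C.center_append w n a).symm

theorem continuous_point (w : Address) (n : ℕ) : Continuous (C.point w n) := by
  unfold point
  exact AffineMap.lineMap_continuous

theorem beam_eq (w : Address) (n : ℕ) : C.beam w n = C.point w n '' Icc 0 1 :=
  segment_eq_image_lineMap _ _ _

theorem point_mem_beam (w : Address) (n : ℕ) {r : ℝ} (hr : r ∈ Icc (0 : ℝ) 1) :
    C.point w n r ∈ C.beam w n := by
  rw [beam_eq]; exact mem_image_of_mem _ hr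

theorem point_mem_star (w : Address) (n : ℕ) {r : ℝ} (hr : r ∈ Icc (0 : ℝ) 1) :
    C.point w n r ∈ C.star w := mem_iUnion.2 ⟨n, C.point_mem_beam w n hr⟩

theorem mem_star {w : Address} {x : Plane} :
    x ∈ C.star w ↔ ∃ n, ∃ r ∈ Icc (0 : ℝ) 1, x = C.point w n r := by
  simp only [star, mem_iUnion, beam_eq, mem_image, eq_comm]

theorem center_mem_beam (w : Address) (n : ℕ) : C.center w ∈ C.beam w n := left_mem_segment _ _ _

theorem center_mem_star (w : Address) : C.center w ∈ C.star w :=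
  mem_iUnion.2 ⟨0, C.center_mem_beam w 0⟩

theorem star_subset_D {w : Address} {k : ℕ} (h : w.length < k) : C.star w ⊆ C.D k :=
  fun _ hx => mem_iUnion₂.2 ⟨w, h, hx⟩

theorem D_subset_stars (k : ℕ) : C.D k ⊆ C.stars := subset_iUnion _ k

theorem star_subset_stars (w : Address) : C.star w ⊆ C.stars :=
  (C.star_subset_D (Nat.lt_succ_self _)).trans (C.D_subset_stars _)

theorem stars_subset_Dinf : C.stars ⊆ C.Dinf := subset_closure

theorem isClosed_Dinf : IsClosed C.Dinf := isClosed_closure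

theorem star_append_subset_branch (w u : Address) : C.star (w ++ u) ⊆ C.branch w :=
  (subset_iUnion (fun u => C.star (w ++ u)) u).trans subset_closure

theorem star_subset_branch (w : Address) : C.star w ⊆ C.branch w := by
  simpa using C.star_append_subset_branch w []

theorem isClosed_branch (w : Address) : IsClosed (C.branch w) := isClosed_closure

theorem center_mem_branch (w : Address) : C.center w ∈ C.branch w :=
  C.star_subset_branch w (C.center_mem_star w)

/-- Every point of a star has an itinerary. -/
theorem exists_point_of_mem_star {w : Address} {x : Plane} (h : x ∈ C.star w) :
    x = 0 ∨ ∃ v n, ∃ r ∈ Ioc (0 : ℝ) 1, v.length ≤ w.length ∧ x = C.point v n r := by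
  obtain ⟨n, r, hr, rfl⟩ := C.mem_star.1 h
  rcases hr.1.eq_or_lt with h0 | h0
  · subst h0
    rw [point_zero]
    rcases List.eq_nil_or_concat w with rfl | ⟨v, ⟨m, a⟩, rfl⟩
    · exact .inl C.center_nil
    · exact .inr ⟨v, m, a.val, a.val_mem, by simp, by simp [point_val]⟩
  · exact .inr ⟨w, n, r, ⟨h0, hr.2⟩, le_rfl, rfl⟩

theorem exists_point_of_mem_D {k : ℕ} {x : Plane} (h : x ∈ C.D k) :
    x = 0 ∨ ∃ v n, ∃ r ∈ Ioc (0 : ℝ) 1, v.length < k ∧ x = C.point v n r := by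
  obtain ⟨w, hw, hx⟩ := mem_iUnion₂.1 h
  rcases C.exists_point_of_mem_star hx with h | ⟨v, n, r, hr, hv, h⟩
  · exact .inl h
  · exact .inr ⟨v, n, r, hr, hv.trans_lt hw, h⟩

theorem exists_point_of_mem_stars {x : Plane} (h : x ∈ C.stars) :
    x = 0 ∨ ∃ v n, ∃ r ∈ Ioc (0 : ℝ) 1, x = C.point v n r := by
  obtain ⟨k, hx⟩ := mem_iUnion.1 h
  rcases C.exists_point_of_mem_D hx with h | ⟨v, n, r, hr, hv, h⟩
  · exact .inl h
  · exact .inr ⟨v, n, r, hr, h⟩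

theorem center_mem_stars (w : Address) : C.center w ∈ C.stars :=
  C.star_subset_stars w (C.center_mem_star w)

theorem point_mem_stars (w : Address) (n : ℕ) {r : ℝ} (hr : r ∈ Icc (0 : ℝ) 1) :
    C.point w n r ∈ C.stars := C.star_subset_stars w (C.point_mem_star w n hr)

theorem center_mem_Dinf (w : Address) : C.center w ∈ C.Dinf :=
  C.stars_subset_Dinf (C.center_mem_stars w)

variable {C}

theorem ActsOnItineraries.apply_center {f : C.Dinf → C.Dinf} (hf : C.ActsOnItineraries f)
    (w : Address) (x : C.Dinf) (hx : (x : Plane) = C.center w) :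
    (f x : Plane) = C.center (shiftAddress w) := by
  rcases List.eq_nil_or_concat w with rfl | ⟨v, ⟨m, b⟩, rfl⟩
  · rw [C.center_nil] at hx
    rw [hf.origin x hx]
    exact C.center_nil.symm
  · rw [List.concat_eq_append] at *
    rw [← C.point_val] at hx
    match v, m, hx with
    | [], 0, hx =>
      rw [hf.beam_zero _ b.val_mem x hx]
      exact C.center_nil.symm
    | [], n + 1, hx =>
      rw [hf.beam_succ _ _ b.val_mem x hx, C.point_val]
      rfl
    | (n + 1, a) :: w, m, hx =>
      rw [hf.star_succ _ _ _ _ _ b.val_mem x hx, C.point_val]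
      rfl
    | [(0, a)], m, hx =>
      rw [hf.star_zero _ _ _ b.val_mem x hx, C.point_val]
      rfl
    | (0, a) :: (n, c) :: w, m, hx =>
      rw [hf.star_zero_cons _ _ _ _ _ _ b.val_mem x hx, C.point_val]
      rfl

theorem ActsOnItineraries.iterate_center {f : C.Dinf → C.Dinf} (hf : C.ActsOnItineraries f)
    (k : ℕ) (w : Address) (x : C.Dinf) (hx : (x : Plane) = C.center w) :
    (f^[k] x : Plane) = C.center (shiftAddress^[k] w) := by
  induction k with
  | zero => exact hx
  | succ k ih =>
    rw [Function.iterate_succ_apply', Function.iterate_succ_apply']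
    exact hf.apply_center _ _ ih

/-- Every non-empty open set contains a branch. -/
theorem IsAdmissible.exists_branch_subset (hC : C.IsAdmissible) {O : Set Plane} (hO : IsOpen O)
    (hne : (O ∩ C.Dinf).Nonempty) : ∃ w, w ≠ [] ∧ C.branch w ⊆ O := by
  obtain ⟨x, hxO, hx⟩ := hne
  obtain ⟨y, hyO, hy⟩ := mem_closure_iff.1 hx O hO hxO
  obtain ⟨v, n, r, hr, hyp⟩ : ∃ v n, ∃ r ∈ Icc (0 : ℝ) 1, y = C.point v n r := by
    obtain ⟨k, hk⟩ := mem_iUnion.1 hy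
    obtain ⟨v, _, hv⟩ := mem_iUnion₂.1 hk
    obtain ⟨n, r, hr, h⟩ := C.mem_star.1 hv
    exact ⟨v, n, r, hr, h⟩
  subst hyp
  obtain ⟨ε, hε, hball⟩ := Metric.isOpen_iff.1 hO _ hyO
  obtain ⟨δ, hδ, hcont⟩ := Metric.continuous_iff.1 (C.continuous_point v n) r (ε / 2) (by positivity)
  obtain ⟨s, t, hs, hst, ht, hsub⟩ : ∃ s t : ℝ, 0 ≤ s ∧ s < t ∧ t ≤ 1 ∧
      ∀ q, s < q → q < t → dist q r < δ := by
    refine ⟨max 0 (r - δ / 2), min 1 (r + δ / 2), le_max_left _ _, ?_, min_le_left _ _, ?_⟩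
    · have := hr.1
      have := hr.2
      apply max_lt <;> apply lt_min <;> linarith
    · intro q h1 h2
      have h3 := (le_max_right _ _).trans_lt h1
      have h4 := h2.trans_le (min_le_right _ _)
      rw [Real.dist_eq, abs_lt]
      constructor <;> linarith
  -- Infinitely many dyadics near `r` give infinitely many distinct addresses with centres close to
  -- the given point. Only finitely many branches are large, so one of these is small enough to fit
  -- into the ball.
  have hinf := Dyadic.infinite_between hs hst ht
  have hfin : {w : Address | ¬ Metric.ediam (C.branch w) < ENNReal.ofReal (ε / 2)}.Finite :=
    (hC.tendsto_diam_branch.eventually (gt_mem_nhds (by simpa using hε)))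
  have hinj : InjOn (fun a : Dyadic => v ++ [(n, a)]) {a : Dyadic | s < a.val ∧ a.val < t} := by
    intro a _ b _ h
    simpa using h
  obtain ⟨_, ⟨a, ha, rfl⟩, hw⟩ := ((hinf.image hinj).sdiff hfin).nonempty
  refine ⟨v ++ [(n, a)], by simp, ?_⟩
  rw [mem_ofPred_eq, not_not] at hw
  intro z hz
  apply hball
  have h1 := hcont a.val (hsub _ ha.1 ha.2)
  rw [C.point_val] at h1
  have h2 : edist z (C.center (v ++ [(n, a)])) < ENNReal.ofReal (ε / 2) :=
    (Metric.edist_le_ediam_of_mem hz (C.center_mem_branch _)).trans_lt hw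
  rw [edist_lt_ofReal] at h2
  rw [Metric.mem_ball]
  linarith [dist_triangle z (C.center (v ++ [(n, a)])) (C.point v n r)]

theorem IsAdmissible.isTransitiveMap (hC : C.IsAdmissible) {f : C.Dinf → C.Dinf}
    (hf : C.ActsOnItineraries f) : IsTransitiveMap f := by
  intro U V hU hV hUne hVne
  obtain ⟨U, hU', rfl⟩ := isOpen_induced_iff.1 hU
  obtain ⟨V, hV', rfl⟩ := isOpen_induced_iff.1 hV
  obtain ⟨x, hx⟩ := hUne
  obtain ⟨y, hy⟩ := hVne
  obtain ⟨w, hw, hwU⟩ := hC.exists_branch_subset hU' ⟨x, hx, x.2⟩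
  obtain ⟨v, hv, hvV⟩ := hC.exists_branch_subset hV' ⟨y, hy, y.2⟩
  obtain ⟨u, k, hk, h⟩ := exists_iterate_shiftAddress_eq v hv w hw
  refine ⟨k, hk, f^[k] ⟨C.center (w ++ u), C.center_mem_Dinf _⟩, mem_image_of_mem _ ?_, ?_⟩
  · exact hwU (C.star_append_subset_branch w u (C.center_mem_star _))
  · rw [mem_preimage, hf.iterate_center k (w ++ u) _ rfl, h]
    exact hvV (C.center_mem_branch v)

end StarSystem

/-! ### Gluing along null families -/

section Null

variable {X Y ι : Type*} [PseudoEMetricSpace X] [PseudoEMetricSpace Y]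

/-- A closed set together with a null family of closed sets that meet it is closed. -/
theorem isClosed_union_iUnion_of_null {A : Set X} {P : ι → Set X} (hA : IsClosed A)
    (hP : ∀ i, IsClosed (P i)) (hAP : ∀ i, (A ∩ P i).Nonempty)
    (hnull : Tendsto (fun i => Metric.ediam (P i)) cofinite (𝓝 0)) :
    IsClosed (A ∪ ⋃ i, P i) := by
  rw [← isOpen_compl_iff, isOpen_iff_mem_nhds]
  intro x hx
  simp only [mem_compl_iff, mem_union, mem_iUnion, not_or, not_exists] at hx
  obtain ⟨δ, hδ, hball⟩ := EMetric.mem_nhds_iff.1 (hA.isOpen_compl.mem_nhds hx.1)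
  have hδ2 : 0 < δ / 2 := ENNReal.half_pos hδ.ne'
  have hfin : {i | ¬ Metric.ediam (P i) < δ / 2}.Finite :=
    hnull.eventually (gt_mem_nhds hδ2)
  have h1 : ∀ᶠ y in 𝓝 x, ∀ i ∈ {i | ¬ Metric.ediam (P i) < δ / 2}, y ∉ P i :=
    (Filter.eventually_all_finite hfin).2 fun i _ => (hP i).isOpen_compl.mem_nhds (hx.2 i)
  filter_upwards [h1, Metric.eball_mem_nhds x hδ2] with y hy1 hy2
  simp only [mem_compl_iff, mem_union, mem_iUnion, not_or, not_exists]
  have hlt : δ / 2 ≤ δ := ENNReal.half_le_self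
  refine ⟨hball (Metric.eball_subset_eball hlt hy2), fun i hi => ?_⟩
  -- A small member containing `y` also contains a point of `A`, which would then lie within `δ` of
  -- `x`. The finitely many large members are avoided by `h1`.
  by_cases hd : Metric.ediam (P i) < δ / 2
  · obtain ⟨c, hcA, hc⟩ := hAP i
    refine hball ?_ hcA
    rw [Metric.mem_eball] at hy2 ⊢
    calc edist c x ≤ edist c y + edist y x := edist_triangle _ _ _
      _ < δ / 2 + δ / 2 :=
        ENNReal.add_lt_add ((Metric.edist_le_ediam_of_mem hc hi).trans_lt hd) hy2
      _ = δ := ENNReal.add_halves _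
  · exact hy1 i hd hi

/-- Continuity of a map on a set together with a null family of sets that meet it and have a null family
of images. -/
theorem continuousWithinAt_union_iUnion_of_null {g : X → Y} {A : Set X} {P : ι → Set X} {x : X}
    (hA : ContinuousWithinAt g A x) (hP : ∀ i, ContinuousWithinAt g (P i) x)
    (hAP : ∀ i, (A ∩ P i).Nonempty)
    (hnull : Tendsto (fun i => Metric.ediam (P i)) cofinite (𝓝 0))
    (hnull' : Tendsto (fun i => Metric.ediam (g '' P i)) cofinite (𝓝 0)) :
    ContinuousWithinAt g (A ∪ ⋃ i, P i) x := by
  refine EMetric.tendsto_nhds.2 fun ε hε => ?_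
  have hε2 : 0 < ε / 2 := ENNReal.half_pos hε.ne'
  have hA' := eventually_nhdsWithin_iff.1 (EMetric.tendsto_nhds.1 hA (ε / 2) hε2)
  obtain ⟨δ, hδ, hball⟩ := EMetric.mem_nhds_iff.1 hA'
  have hδ2 : 0 < δ / 2 := ENNReal.half_pos hδ.ne'
  have hfin : {i | ¬ (Metric.ediam (P i) < δ / 2 ∧ Metric.ediam (g '' P i) < ε / 2)}.Finite :=
    (hnull.eventually (gt_mem_nhds hδ2)).and (hnull'.eventually (gt_mem_nhds hε2))
  have h1 : ∀ᶠ y in 𝓝 x, ∀ i ∈ {i | ¬ (Metric.ediam (P i) < δ / 2 ∧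
      Metric.ediam (g '' P i) < ε / 2)}, y ∈ P i → edist (g y) (g x) < ε :=
    (Filter.eventually_all_finite hfin).2 fun i _ =>
      eventually_nhdsWithin_iff.1 (EMetric.tendsto_nhds.1 (hP i) ε hε)
  have hlt : δ / 2 ≤ δ := ENNReal.half_le_self
  rw [eventually_nhdsWithin_iff]
  filter_upwards [h1, Metric.eball_mem_nhds x hδ2] with y hy1 hy2 hy
  rcases hy with hy | hy
  · exact (hball (Metric.eball_subset_eball hlt hy2) hy).trans_le ENNReal.half_le_self
  · obtain ⟨i, hi⟩ := mem_iUnion.1 hy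
    by_cases hd : Metric.ediam (P i) < δ / 2 ∧ Metric.ediam (g '' P i) < ε / 2
    · obtain ⟨c, hcA, hc⟩ := hAP i
      have hcx : c ∈ Metric.eball x δ := by
        rw [Metric.mem_eball] at hy2 ⊢
        calc edist c x ≤ edist c y + edist y x := edist_triangle _ _ _
          _ < δ / 2 + δ / 2 :=
            ENNReal.add_lt_add ((Metric.edist_le_ediam_of_mem hc hi).trans_lt hd.1) hy2
          _ = δ := ENNReal.add_halves _
      calc edist (g y) (g x) ≤ edist (g y) (g c) + edist (g c) (g x) := edist_triangle _ _ _
        _ < ε / 2 + ε / 2 := ENNReal.add_lt_add ((Metric.edist_le_ediam_of_mem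
            (mem_image_of_mem g hi) (mem_image_of_mem g hc)).trans_lt hd.2) (hball hcx hcA)
        _ = ε := ENNReal.add_halves _
    · exact hy1 i hd hi

/-- Off a closed set the condition is void. This lets the gluing lemma be applied at a point without
asking which pieces contain it. -/
theorem continuousWithinAt_of_continuousOn_isClosed {g : X → Y} {A : Set X}
    (h : ContinuousOn g A) (hA : IsClosed A) (x : X) : ContinuousWithinAt g A x := by
  by_cases hx : x ∈ A
  · exact h x hx
  · exact continuousWithinAt_of_notMem_closure (by rwa [hA.closure_eq])

end Null

/-! ### Uniqueness of itineraries and topology of the branches -/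

namespace StarSystem

variable {C : StarSystem}

namespace IsAdmissible

theorem point_injective (hC : C.IsAdmissible) (w : Address) (n : ℕ) :
    Function.Injective (C.point w n) :=
  AffineMap.lineMap_injective ℝ (hC.tip_ne_center w n).symm

theorem center_mem_D {w : Address} (hw : w ≠ []) : C.center w ∈ C.D w.length := by
  rcases List.eq_nil_or_concat w with rfl | ⟨v, ⟨m, a⟩, rfl⟩
  · exact absurd rfl hw
  · rw [List.concat_eq_append, ← C.point_val]
    exact C.star_subset_D (by simp) (C.point_mem_star v m a.val_mem_Icc)

theorem eq_center (hC : C.IsAdmissible) {w : Address} (hw : w ≠ []) {x : Plane}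
    (hx : x ∈ C.branch w) {k : ℕ} (hk : k ≤ w.length) (hx' : x ∈ C.D k) : x = C.center w := by
  have h : x ∈ C.branch w ∩ C.D w.length := by
    refine ⟨hx, ?_⟩
    obtain ⟨v, hv, hxv⟩ := mem_iUnion₂.1 hx'
    exact C.star_subset_D (hv.trans_le hk) hxv
  rw [hC.branch_inter_D w hw] at h
  exact h

theorem point_mem_branch_take (w : Address) (n : ℕ) {r : ℝ} (hr : r ∈ Icc (0 : ℝ) 1) (k : ℕ) :
    C.point w n r ∈ C.branch (w.take k) := by
  apply C.star_append_subset_branch (w.take k) (w.drop k)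
  rw [List.take_append_drop]
  exact C.point_mem_star w n hr

/-- A later star meets the earlier ones in its centre only, and `0 < s` excludes the centre. -/
theorem point_ne_of_length_lt (hC : C.IsAdmissible) {v w : Address} (h : v.length < w.length)
    (m n : ℕ) {r s : ℝ} (hr : r ∈ Icc (0 : ℝ) 1) (hs : s ∈ Ioc (0 : ℝ) 1) :
    C.point v m r ≠ C.point w n s := by
  intro heq
  have h1 : C.point w n s = C.center w := by
    refine hC.eq_center (by rintro rfl; simp at h)
      (C.star_subset_branch w (C.point_mem_star w n (Ioc_subset_Icc_self hs))) le_rfl ?_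
    rw [← heq]
    exact C.star_subset_D h (C.point_mem_star v m hr)
  rw [← C.point_zero w n] at h1
  exact hs.1.ne' (hC.point_injective w n h1)

/-- Itineraries are unique. -/
theorem point_eq_iff (hC : C.IsAdmissible) {v w : Address} {m n : ℕ} {r s : ℝ}
    (hr : r ∈ Ioc (0 : ℝ) 1) (hs : s ∈ Ioc (0 : ℝ) 1) (h : C.point v m r = C.point w n s) :
    v = w ∧ m = n ∧ r = s := by
  have hr' := Ioc_subset_Icc_self hr
  have hs' := Ioc_subset_Icc_self hs
  rcases lt_trichotomy v.length w.length with hl | hl | hl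
  · exact absurd h (hC.point_ne_of_length_lt hl m n hr' hs)
  · have hvw : v = w := by
      by_contra hne
      have := hC.disjoint_branch v w hl hne
      refine this.le_bot ⟨C.star_subset_branch v (C.point_mem_star v m hr'), ?_⟩
      rw [h]
      exact C.star_subset_branch w (C.point_mem_star w n hs')
    subst hvw
    have hmn : m = n := by
      by_contra hne
      have h1 : C.point v m r ∈ C.beam v m ∩ C.beam v n :=
        ⟨C.point_mem_beam v m hr', by rw [h]; exact C.point_mem_beam v n hs'⟩
      rw [hC.beam_inter_beam v m n hne, mem_singleton_iff, ← C.point_zero v m] at h1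
      exact hr.1.ne' (hC.point_injective v m h1)
    subst hmn
    exact ⟨rfl, rfl, hC.point_injective v m h⟩
  · exact absurd h.symm (hC.point_ne_of_length_lt hl n m hs' hr)

theorem point_ne_zero (hC : C.IsAdmissible) (w : Address) (n : ℕ) {r : ℝ}
    (hr : r ∈ Ioc (0 : ℝ) 1) : C.point w n r ≠ 0 := by
  rw [← C.center_nil, ← C.point_zero [] 0]
  rcases Nat.eq_zero_or_pos w.length with h | h
  · rw [List.length_eq_zero_iff] at h
    subst h
    rw [C.point_zero, ← C.point_zero [] n]
    exact fun h => hr.1.ne' (hC.point_injective [] n h)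
  · exact (hC.point_ne_of_length_lt (v := []) h 0 n ⟨le_rfl, zero_le_one⟩ hr).symm

/-- The itineraries of the points of a branch. -/
theorem point_mem_branch (hC : C.IsAdmissible) {w : Address} (hw : w ≠ []) {v : Address} {n : ℕ}
    {r : ℝ} (hr : r ∈ Ioc (0 : ℝ) 1) (h : C.point v n r ∈ C.branch w) :
    (∃ u, v = w ++ u) ∨ ∃ a : Dyadic, w = v ++ [(n, a)] ∧ r = a.val := by
  have hr' := Ioc_subset_Icc_self hr
  rcases le_or_gt w.length v.length with hl | hl
  · left
    have h1 := point_mem_branch_take (C := C) v n hr' w.length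
    have h2 : v.take w.length = w := by
      by_contra hne
      exact (hC.disjoint_branch _ w (by simpa using hl) hne).le_bot ⟨h1, h⟩
    exact ⟨v.drop w.length, by conv_lhs => rw [← List.take_append_drop w.length v, h2]⟩
  · right
    have h1 := hC.eq_center hw h hl (C.star_subset_D (Nat.lt_succ_self _) (C.point_mem_star v n hr'))
    rcases List.eq_nil_or_concat w with rfl | ⟨w, ⟨m, a⟩, rfl⟩
    · exact absurd rfl hw
    · rw [List.concat_eq_append] at *
      rw [← C.point_val] at h1
      obtain ⟨rfl, rfl, rfl⟩ := hC.point_eq_iff hr a.val_mem h1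
      exact ⟨a, rfl, rfl⟩

/-- The point could only be the centre of the branch, but that centre lies at a positive proportion
on a star one level after `v`. With `v.length + 1` the claim would fail at the dyadic points of the
beam. -/
theorem point_notMem_branch (hC : C.IsAdmissible) {w v : Address} {n : ℕ} {r : ℝ}
    (hr : r ∈ Icc (0 : ℝ) 1) (hw : w.length = v.length + 2) : C.point v n r ∉ C.branch w := by
  intro h
  have h1 := hC.eq_center (by rintro rfl; simp at hw) h (k := v.length + 1) (by omega)
    (C.star_subset_D (Nat.lt_succ_self _) (C.point_mem_star v n hr))
  rcases List.eq_nil_or_concat w with rfl | ⟨w, ⟨m, a⟩, rfl⟩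
  · simp at hw
  · rw [List.concat_eq_append] at *
    rw [← C.point_val] at h1
    exact hC.point_ne_of_length_lt (by simp at hw; omega) n m hr a.val_mem h1

theorem isClosed_beam (w : Address) (n : ℕ) : IsClosed (C.beam w n) := by
  rw [beam_eq]
  exact (isCompact_Icc.image (C.continuous_point w n)).isClosed

theorem star_eq_union (w : Address) : C.star w = {C.center w} ∪ ⋃ n, C.beam w n := by
  rw [star, eq_comm, union_eq_right, singleton_subset_iff]
  exact C.center_mem_star w

theorem isClosed_star (hC : C.IsAdmissible) (w : Address) : IsClosed (C.star w) := by
  rw [star_eq_union]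
  refine isClosed_union_iUnion_of_null isClosed_singleton (fun n => isClosed_beam w n)
    (fun n => ⟨_, rfl, C.center_mem_beam w n⟩) ?_
  rw [Nat.cofinite_eq_atTop]
  exact hC.tendsto_diam_beam w

theorem D_one : C.D 1 = C.star [] := by
  ext x
  simp [D, List.length_eq_zero_iff]

theorem D_succ (k : ℕ) : C.D (k + 1) = C.D k ∪ ⋃ w : {w : Address // w.length = k}, C.star w := by
  ext x
  simp only [D, mem_iUnion, mem_union, Subtype.exists, exists_prop, Nat.lt_succ_iff_lt_or_eq,
    or_and_right, exists_or]

theorem tendsto_ediam_star (hC : C.IsAdmissible) :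
    Tendsto (fun w : Address => Metric.ediam (C.star w)) cofinite (𝓝 0) :=
  tendsto_of_tendsto_of_tendsto_of_le_of_le tendsto_const_nhds hC.tendsto_diam_branch
    (fun _ => zero_le) (fun w => Metric.ediam_mono (C.star_subset_branch w))

theorem tendsto_subtype_ediam {F : Address → Set Plane}
    (hF : Tendsto (fun w : Address => Metric.ediam (F w)) cofinite (𝓝 0)) (k : ℕ) :
    Tendsto (fun w : {w : Address // w.length = k} => Metric.ediam (F w)) cofinite (𝓝 0) :=
  hF.comp Subtype.val_injective.tendsto_cofinite

theorem isClosed_D (hC : C.IsAdmissible) (k : ℕ) : IsClosed (C.D k) := by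
  induction k with
  | zero => simp [D]
  | succ k ih =>
    rcases Nat.eq_zero_or_pos k with rfl | hk
    · rw [zero_add, D_one]
      exact hC.isClosed_star []
    · rw [D_succ]
      refine isClosed_union_iUnion_of_null ih (fun w => hC.isClosed_star w) ?_
        (tendsto_subtype_ediam hC.tendsto_ediam_star k)
      rintro ⟨w, rfl⟩
      exact ⟨_, center_mem_D (List.length_pos_iff.1 hk), C.center_mem_star w⟩

/-- The predicate serves two uses: all branches of one level, to decompose `Dinf`, and all but one,
to show that the remaining one is a relative neighbourhood. -/
theorem isClosed_D_union_branch (hC : C.IsAdmissible) {k : ℕ} (hk : 0 < k)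
    (p : {w : Address // w.length = k} → Prop) :
    IsClosed (C.D k ∪ ⋃ w : {w : {w : Address // w.length = k} // p w}, C.branch w) := by
  refine isClosed_union_iUnion_of_null (hC.isClosed_D k) (fun w => C.isClosed_branch w) ?_
    ((tendsto_subtype_ediam hC.tendsto_diam_branch k).comp Subtype.val_injective.tendsto_cofinite)
  rintro ⟨⟨w, rfl⟩, _⟩
  exact ⟨_, center_mem_D (List.length_pos_iff.1 hk), C.center_mem_branch w⟩

theorem mem_D_or_mem_branch (k : ℕ) {x : Plane} (hx : x ∈ C.stars) :
    x ∈ C.D k ∨ ∃ w : Address, w.length = k ∧ x ∈ C.branch w := by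
  obtain ⟨j, hj⟩ := mem_iUnion.1 hx
  obtain ⟨v, _, hv⟩ := mem_iUnion₂.1 hj
  rcases lt_or_ge v.length k with h | h
  · exact .inl (C.star_subset_D h hv)
  · refine .inr ⟨v.take k, by simpa using h, ?_⟩
    apply C.star_append_subset_branch (v.take k) (v.drop k)
    rwa [List.take_append_drop]

theorem mem_D_or_mem_branch_of_mem_Dinf (hC : C.IsAdmissible) {k : ℕ} (hk : 0 < k) {x : Plane}
    (hx : x ∈ C.Dinf) : x ∈ C.D k ∨ ∃ w : Address, w.length = k ∧ x ∈ C.branch w := by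
  have h : x ∈ C.D k ∪ ⋃ w : {w : {w : Address // w.length = k} // True}, C.branch w := by
    refine closure_minimal (fun y hy => ?_) (hC.isClosed_D_union_branch hk (fun _ => True)) hx
    rcases mem_D_or_mem_branch k hy with h | ⟨w, hw, h⟩
    · exact .inl h
    · exact .inr (mem_iUnion.2 ⟨⟨⟨w, hw⟩, trivial⟩, h⟩)
  rcases h with h | h
  · exact .inl h
  · obtain ⟨w, hw⟩ := mem_iUnion.1 h
    exact .inr ⟨w.1.1, w.1.2, hw⟩

/-- A branch is a neighbourhood, within the union of all stars, of its points outside of `D k`. -/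
theorem eventually_mem_branch (hC : C.IsAdmissible) {w : Address} (hw : w ≠ []) {x : Plane}
    (hx : x ∈ C.branch w) (hx' : x ∉ C.D w.length) :
    ∀ᶠ y in 𝓝 x, y ∈ C.stars → y ∈ C.branch w := by
  have hcl := hC.isClosed_D_union_branch (List.length_pos_iff.2 hw) (fun v => v.1 ≠ w)
  have hxn : x ∉ C.D w.length ∪
      ⋃ v : {v : {v : Address // v.length = w.length} // v.1 ≠ w}, C.branch v := by
    rintro (h | h)
    · exact hx' h
    · obtain ⟨v, hv⟩ := mem_iUnion.1 h
      exact (hC.disjoint_branch _ _ v.1.2 v.2).le_bot ⟨hv, hx⟩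
  filter_upwards [hcl.isOpen_compl.mem_nhds hxn] with y hy hyU
  simp only [mem_compl_iff, mem_union, mem_iUnion, not_or, not_exists] at hy
  rcases mem_D_or_mem_branch w.length hyU with h | ⟨v, hv, h⟩
  · exact absurd h hy.1
  · by_cases hvw : v = w
    · exact hvw ▸ h
    · exact absurd h (hy.2 ⟨⟨v, hv⟩, hvw⟩)

end IsAdmissible

end StarSystem

/-! ### Construction, continuity and extension of the map -/

namespace StarSystem

variable (C : StarSystem)

/-- The image of the point with the itinerary `(w, n, r)`. -/
noncomputable def imagePoint : Address → ℕ → ℝ → Plane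
  | [], 0, _ => 0
  | [], n + 1, r => C.point [] n r
  | (n + 1, a) :: w, m, r => C.point ((n, a) :: w) m r
  | [(0, a)], m, r => C.point [] (m + a.exp) r
  | (0, a) :: (m, b) :: w, n, r => C.point ((m + a.exp, b) :: w) n r

theorem continuous_imagePoint (w : Address) (n : ℕ) : Continuous (C.imagePoint w n) := by
  match w, n with
  | [], 0 => exact continuous_const
  | [], n + 1 => exact C.continuous_point _ _
  | (n + 1, a) :: w, m => exact C.continuous_point _ _
  | [(0, a)], m => exact C.continuous_point _ _
  | (0, a) :: (m, b) :: w, n => exact C.continuous_point _ _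

/-- A centre is both the end `r = 0` of its own beams and a dyadic point of an earlier beam.
Together with `imagePoint_val` this shows that the two prescriptions agree. -/
theorem imagePoint_zero (w : Address) (n : ℕ) :
    C.imagePoint w n 0 = C.center (shiftAddress w) := by
  match w, n with
  | [], 0 => exact C.center_nil.symm
  | [], n + 1 => exact C.point_zero _ _
  | (n + 1, a) :: w, m => exact C.point_zero _ _
  | [(0, a)], m => exact C.point_zero _ _
  | (0, a) :: (m, b) :: w, n => exact C.point_zero _ _

theorem imagePoint_val (w : Address) (n : ℕ) (a : Dyadic) :
    C.imagePoint w n a.val = C.center (shiftAddress (w ++ [(n, a)])) := by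
  match w, n with
  | [], 0 => exact C.center_nil.symm
  | [], n + 1 => exact C.point_val _ _ _
  | (n + 1, a) :: w, m => exact C.point_val _ _ _
  | [(0, a)], m => exact C.point_val _ _ _
  | (0, a) :: (m, b) :: w, n => exact C.point_val _ _ _

theorem imagePoint_mem_star (w : Address) (n : ℕ) {r : ℝ} (hr : r ∈ Icc (0 : ℝ) 1) :
    C.imagePoint w n r ∈ C.star (shiftAddress w) := by
  match w, n with
  | [], 0 =>
    rw [imagePoint, ← C.center_nil]
    exact C.center_mem_star []
  | [], n + 1 => exact C.point_mem_star _ _ hr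
  | (n + 1, a) :: w, m => exact C.point_mem_star _ _ hr
  | [(0, a)], m => exact C.point_mem_star _ _ hr
  | (0, a) :: (m, b) :: w, n => exact C.point_mem_star _ _ hr

theorem actsOnItineraries_iff (f : C.Dinf → C.Dinf) : C.ActsOnItineraries f ↔
    (∀ x : C.Dinf, (x : Plane) = 0 → (f x : Plane) = 0) ∧
    ∀ (w : Address) (n : ℕ) (r : ℝ), r ∈ Ioc (0 : ℝ) 1 → ∀ x : C.Dinf,
      (x : Plane) = C.point w n r → (f x : Plane) = C.imagePoint w n r := by
  constructor
  · intro h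
    refine ⟨h.origin, fun w n r hr x hx => ?_⟩
    match w, n, hx with
    | [], 0, hx => exact h.beam_zero r hr x hx
    | [], n + 1, hx => exact h.beam_succ n r hr x hx
    | (n + 1, a) :: w, m, hx => exact h.star_succ n a w m r hr x hx
    | [(0, a)], m, hx => exact h.star_zero a m r hr x hx
    | (0, a) :: (m, b) :: w, n, hx => exact h.star_zero_cons a m b w n r hr x hx
  · rintro ⟨h0, h⟩
    exact ⟨h0, h [] 0, fun n => h [] (n + 1), fun n a w => h ((n + 1, a) :: w),
      fun a => h [(0, a)], fun a m b w => h ((0, a) :: (m, b) :: w)⟩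

open Classical in
/-- The map on the union of all stars, extended by `0`. -/
noncomputable def itineraryMap (x : Plane) : Plane :=
  if h : ∃ q : Address × ℕ × ℝ, q.2.2 ∈ Ioc (0 : ℝ) 1 ∧ x = C.point q.1 q.2.1 q.2.2 then
    C.imagePoint h.choose.1 h.choose.2.1 h.choose.2.2
  else 0

variable {C}

namespace IsAdmissible

theorem itineraryMap_point (hC : C.IsAdmissible) (w : Address) (n : ℕ) {r : ℝ}
    (hr : r ∈ Ioc (0 : ℝ) 1) : C.itineraryMap (C.point w n r) = C.imagePoint w n r := by
  have h : ∃ q : Address × ℕ × ℝ, q.2.2 ∈ Ioc (0 : ℝ) 1 ∧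
      C.point w n r = C.point q.1 q.2.1 q.2.2 := ⟨(w, n, r), hr, rfl⟩
  obtain ⟨h1, h2, h3⟩ := hC.point_eq_iff hr h.choose_spec.1 h.choose_spec.2
  rw [itineraryMap, dif_pos h, ← h1, ← h2, ← h3]

theorem itineraryMap_zero (hC : C.IsAdmissible) : C.itineraryMap 0 = 0 := by
  rw [itineraryMap, dif_neg]
  rintro ⟨⟨w, n, r⟩, hr, h⟩
  exact hC.point_ne_zero w n hr h.symm

theorem itineraryMap_center (hC : C.IsAdmissible) (w : Address) :
    C.itineraryMap (C.center w) = C.center (shiftAddress w) := by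
  rcases List.eq_nil_or_concat w with rfl | ⟨w, ⟨m, a⟩, rfl⟩
  · rw [C.center_nil, hC.itineraryMap_zero]
    exact C.center_nil.symm
  · rw [List.concat_eq_append, ← C.point_val, hC.itineraryMap_point w m a.val_mem, C.imagePoint_val]

theorem itineraryMap_point' (hC : C.IsAdmissible) (w : Address) (n : ℕ) {r : ℝ}
    (hr : r ∈ Icc (0 : ℝ) 1) : C.itineraryMap (C.point w n r) = C.imagePoint w n r := by
  rcases hr.1.eq_or_lt with h | h
  · rw [← h, C.point_zero, C.imagePoint_zero, hC.itineraryMap_center]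
  · exact hC.itineraryMap_point w n ⟨h, hr.2⟩

theorem itineraryMap_image_star (hC : C.IsAdmissible) (w : Address) :
    C.itineraryMap '' C.star w ⊆ C.star (shiftAddress w) := by
  rintro _ ⟨x, hx, rfl⟩
  obtain ⟨n, r, hr, rfl⟩ := C.mem_star.1 hx
  rw [hC.itineraryMap_point' w n hr]
  exact C.imagePoint_mem_star w n hr

theorem itineraryMap_mem_stars (hC : C.IsAdmissible) {x : Plane} (hx : x ∈ C.stars) :
    C.itineraryMap x ∈ C.stars := by
  obtain ⟨k, hk⟩ := mem_iUnion.1 hx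
  obtain ⟨w, _, hw⟩ := mem_iUnion₂.1 hk
  exact C.star_subset_stars _ (hC.itineraryMap_image_star w (mem_image_of_mem _ hw))

/-- From length two on, `shiftAddress` commutes with appending, so the stars that grow from `w` go
to stars that grow from its image. -/
theorem itineraryMap_mem_branch (hC : C.IsAdmissible) {w : Address} (hw : 2 ≤ w.length)
    {x : Plane} (hx : x ∈ C.stars) (hxw : x ∈ C.branch w) :
    C.itineraryMap x ∈ C.branch (shiftAddress w) := by
  have hne : w ≠ [] := by rintro rfl; simp at hw
  rcases C.exists_point_of_mem_stars hx with rfl | ⟨v, n, r, hr, rfl⟩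
  · have h := hC.eq_center hne hxw (k := 1) (by omega)
      (C.star_subset_D Nat.one_pos (by rw [← C.center_nil]; exact C.center_mem_star []))
    rw [h, hC.itineraryMap_center]
    exact C.center_mem_branch _
  · rw [hC.itineraryMap_point v n hr]
    rcases hC.point_mem_branch hne hr hxw with ⟨u, rfl⟩ | ⟨a, rfl, rfl⟩
    · have := C.imagePoint_mem_star (w ++ u) n (Ioc_subset_Icc_self hr)
      rw [shiftAddress_append hw] at this
      exact C.star_append_subset_branch _ _ this
    · rw [C.imagePoint_val]
      exact C.center_mem_branch _

theorem continuousOn_beam (hC : C.IsAdmissible) (w : Address) (n : ℕ) :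
    ContinuousOn C.itineraryMap (C.beam w n) := by
  set d := C.tip w n - C.center w with hd
  have hd0 : inner ℝ d d ≠ 0 := by
    rw [inner_self_ne_zero]
    exact sub_ne_zero.2 (hC.tip_ne_center w n)
  -- Orthogonal projection onto the direction of the beam recovers the parameter `r` continuously.
  have hcont : Continuous fun x : Plane =>
      C.imagePoint w n (inner ℝ d (x - C.center w) / inner ℝ d d) :=
    (C.continuous_imagePoint w n).comp (by fun_prop)
  refine hcont.continuousOn.congr fun x hx => ?_
  rw [beam_eq] at hx
  obtain ⟨r, hr, rfl⟩ := hx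
  rw [hC.itineraryMap_point' w n hr]
  congr 1
  have : C.point w n r - C.center w = r • d := by
    simp [point, AffineMap.lineMap_apply, hd]
  rw [this, inner_smul_right, mul_div_assoc, div_self hd0, mul_one]

/-- Since beam indices do not decrease, tails of a star go to tails of its image, so the images of
the beams still shrink. The first star, where indices drop by one, is treated apart. -/
theorem itineraryMap_image_beam (hC : C.IsAdmissible) {w : Address} (hw : w ≠ []) (n : ℕ) :
    ∃ k, n ≤ k ∧ C.itineraryMap '' C.beam w n ⊆ C.beam (shiftAddress w) k := by
  have key : ∀ k, (∀ r, C.imagePoint w n r = C.point (shiftAddress w) k r) →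
      C.itineraryMap '' C.beam w n ⊆ C.beam (shiftAddress w) k := by
    rintro k hk _ ⟨x, hx, rfl⟩
    rw [beam_eq] at hx
    obtain ⟨r, hr, rfl⟩ := hx
    rw [hC.itineraryMap_point' w n hr, hk]
    exact C.point_mem_beam _ _ hr
  match w, hw with
  | (m + 1, a) :: w, _ => exact ⟨n, le_rfl, key n fun r => rfl⟩
  | [(0, a)], _ => exact ⟨n + a.exp, by omega, key (n + a.exp) fun r => rfl⟩
  | (0, a) :: (m, b) :: w, _ => exact ⟨n, le_rfl, key n fun r => rfl⟩

theorem tendsto_ediam_image_beam (hC : C.IsAdmissible) (w : Address) :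
    Tendsto (fun n => Metric.ediam (C.itineraryMap '' C.beam w n)) atTop (𝓝 0) := by
  rcases eq_or_ne w [] with rfl | hw
  · rw [← tendsto_add_atTop_iff_nat 1]
    refine tendsto_of_tendsto_of_tendsto_of_le_of_le tendsto_const_nhds (hC.tendsto_diam_beam [])
      (fun _ => zero_le) (fun n => Metric.ediam_mono ?_)
    rintro _ ⟨x, hx, rfl⟩
    rw [beam_eq] at hx
    obtain ⟨r, hr, rfl⟩ := hx
    rw [hC.itineraryMap_point' [] (n + 1) hr]
    exact C.point_mem_beam _ _ hr
  · choose k hk hsub using hC.itineraryMap_image_beam hw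
    have hk' : Tendsto k atTop atTop := tendsto_atTop_mono hk tendsto_id
    exact tendsto_of_tendsto_of_tendsto_of_le_of_le tendsto_const_nhds
      ((hC.tendsto_diam_beam (shiftAddress w)).comp hk') (fun _ => zero_le)
      (fun n => Metric.ediam_mono (hsub n))

theorem continuousOn_star (hC : C.IsAdmissible) (w : Address) :
    ContinuousOn C.itineraryMap (C.star w) := by
  rw [star_eq_union]
  intro x _
  refine continuousWithinAt_union_iUnion_of_null
    (continuousWithinAt_of_continuousOn_isClosed (continuousOn_singleton _ _) isClosed_singleton x)
    (fun n => continuousWithinAt_of_continuousOn_isClosed (hC.continuousOn_beam w n)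
      (isClosed_beam w n) x)
    (fun n => ⟨_, rfl, C.center_mem_beam w n⟩) ?_ ?_
  · rw [Nat.cofinite_eq_atTop]
    exact hC.tendsto_diam_beam w
  · rw [Nat.cofinite_eq_atTop]
    exact hC.tendsto_ediam_image_beam w

/-- The union of all but finitely many beams of the first star has a small diameter. -/
theorem exists_ediam_tail_lt (hC : C.IsAdmissible) {ε : ENNReal} (hε : 0 < ε) :
    ∃ N, Metric.ediam (⋃ n ≥ N, C.beam [] n) < ε := by
  obtain ⟨δ, hδ, hδε⟩ := exists_between hε
  have hδ2 : 0 < δ / 2 := ENNReal.half_pos hδ.ne'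
  obtain ⟨N, hN⟩ := eventually_atTop.1 ((hC.tendsto_diam_beam []).eventually (gt_mem_nhds hδ2))
  refine ⟨N, lt_of_le_of_lt (Metric.ediam_le fun x hx y hy => ?_) hδε⟩
  obtain ⟨m, hm, hx⟩ := mem_iUnion₂.1 hx
  obtain ⟨n, hn, hy⟩ := mem_iUnion₂.1 hy
  calc edist x y ≤ edist x (C.center []) + edist (C.center []) y := edist_triangle _ _ _
    _ ≤ δ / 2 + δ / 2 := add_le_add
      ((Metric.edist_le_ediam_of_mem hx (C.center_mem_beam [] m)).trans (hN m hm).le)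
      ((Metric.edist_le_ediam_of_mem (C.center_mem_beam [] n) hy).trans (hN n hn).le)
    _ = δ := ENNReal.add_halves _

/-- Only finitely many branches are large, and each non-empty address has finitely many preimages.
-/
theorem finite_shiftAddress_bad (hC : C.IsAdmissible) {ε : ENNReal} (hε : 0 < ε) :
    {w : Address | shiftAddress w ≠ [] ∧ ¬ Metric.ediam (C.branch (shiftAddress w)) < ε}.Finite := by
  have hfin : {v : Address | ¬ Metric.ediam (C.branch v) < ε}.Finite :=
    hC.tendsto_diam_branch.eventually (gt_mem_nhds hε)
  refine ((hfin.sdiff (t := {[]})).biUnion (t := fun v => {w | shiftAddress w = v})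
    fun v hv => finite_shiftAddress_eq v hv.2).subset ?_
  intro w hw
  exact mem_iUnion₂.2 ⟨shiftAddress w, ⟨hw.2, hw.1⟩, rfl⟩

theorem tendsto_ediam_image_star (hC : C.IsAdmissible) :
    Tendsto (fun w : Address => Metric.ediam (C.itineraryMap '' C.star w)) cofinite (𝓝 0) := by
  refine ENNReal.tendsto_nhds_zero.2 fun ε hε => ?_
  obtain ⟨N, hN⟩ := hC.exists_ediam_tail_lt hε
  refine Set.Finite.subset (((hC.finite_shiftAddress_bad hε).union
    ((Dyadic.finite_exp_le N).image fun a => [(0, a)])).union (finite_singleton [])) ?_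
  intro w hw
  simp only [mem_compl_iff, mem_ofPred_eq, not_le] at hw
  by_cases hnil : shiftAddress w = []
  · match w, hnil with
    | [], _ => exact .inr rfl
    | [(0, a)], _ =>
      refine .inl (.inr ⟨a, ?_, rfl⟩)
      by_contra ha
      simp only [mem_ofPred_eq, not_le] at ha
      -- The star at `[(0, a)]` goes into the beams of the first star with index at least `a.exp >
      -- N`, a tail of small diameter.
      refine (hw.trans_le (Metric.ediam_mono ?_)).not_gt hN
      rintro _ ⟨x, hx, rfl⟩
      obtain ⟨n, r, hr, rfl⟩ := C.mem_star.1 hx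
      rw [hC.itineraryMap_point' _ n hr]
      exact mem_iUnion₂.2 ⟨n + a.exp, by omega, C.point_mem_beam [] _ hr⟩
  · refine .inl (.inl ⟨hnil, fun h => ?_⟩)
    exact (hw.trans_le (Metric.ediam_mono ((hC.itineraryMap_image_star w).trans
      (C.star_subset_branch _)))).not_gt h

theorem continuousOn_D (hC : C.IsAdmissible) (k : ℕ) : ContinuousOn C.itineraryMap (C.D k) := by
  induction k with
  | zero => simp [D]
  | succ k ih =>
    rcases Nat.eq_zero_or_pos k with rfl | hk
    · rw [zero_add, D_one]
      exact hC.continuousOn_star []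
    · rw [D_succ]
      intro x _
      refine continuousWithinAt_union_iUnion_of_null
        (continuousWithinAt_of_continuousOn_isClosed ih (hC.isClosed_D k) x)
        (fun w => continuousWithinAt_of_continuousOn_isClosed (hC.continuousOn_star w)
          (hC.isClosed_star w) x)
        ?_ (tendsto_subtype_ediam hC.tendsto_ediam_star k)
        (hC.tendsto_ediam_image_star.comp Subtype.val_injective.tendsto_cofinite)
      rintro ⟨w, rfl⟩
      exact ⟨_, center_mem_D (List.length_pos_iff.1 hk), C.center_mem_star w⟩

theorem tendsto_ediam_image_branch (hC : C.IsAdmissible) {k : ℕ} (hk : 2 ≤ k) :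
    Tendsto (fun w : {w : Address // w.length = k} =>
      Metric.ediam (C.itineraryMap '' (C.branch w ∩ C.stars))) cofinite (𝓝 0) := by
  refine ENNReal.tendsto_nhds_zero.2 fun ε hε => ?_
  refine Set.Finite.subset ((hC.finite_shiftAddress_bad hε).preimage
    Subtype.val_injective.injOn) ?_
  rintro ⟨w, rfl⟩ hw
  simp only [mem_compl_iff, mem_ofPred_eq, not_le] at hw
  refine ⟨?_, fun h => ?_⟩
  · intro h
    have := length_le_shiftAddress w
    rw [h] at this
    simp at this
    omega
  · refine (hw.trans_le (Metric.ediam_mono ?_)).not_gt h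
    rintro _ ⟨x, ⟨hx, hx'⟩, rfl⟩
    exact hC.itineraryMap_mem_branch hk hx' hx

theorem continuousOn_stars (hC : C.IsAdmissible) : ContinuousOn C.itineraryMap C.stars := by
  intro x hx
  obtain ⟨j, hj⟩ := mem_iUnion.1 hx
  obtain ⟨v, _, hv⟩ := mem_iUnion₂.1 hj
  obtain ⟨n, r, hr, rfl⟩ := C.mem_star.1 hv
  -- At this depth the point lies in none of the closed branches, so continuity along each is void.
  -- What matters is `D k` and the smallness of the images.
  set k := v.length + 2 with hk
  have hsub : C.stars ⊆
      C.D k ∪ ⋃ w : {w : Address // w.length = k}, (C.branch w ∩ C.stars) := by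
    intro y hy
    rcases mem_D_or_mem_branch k hy with h | ⟨w, hw, h⟩
    · exact .inl h
    · exact .inr (mem_iUnion.2 ⟨⟨w, hw⟩, h, hy⟩)
  refine ContinuousWithinAt.mono ?_ hsub
  refine continuousWithinAt_union_iUnion_of_null
    (continuousWithinAt_of_continuousOn_isClosed (hC.continuousOn_D k) (hC.isClosed_D k) _) ?_ ?_ ?_
    (hC.tendsto_ediam_image_branch (by omega))
  · rintro ⟨w, hw⟩
    refine continuousWithinAt_of_notMem_closure fun h => ?_
    have h1 := closure_mono inter_subset_left h
    rw [(C.isClosed_branch w).closure_eq] at h1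
    exact hC.point_notMem_branch hr hw h1
  · rintro ⟨w, hw⟩
    refine ⟨C.center w, hw ▸ center_mem_D ?_, C.center_mem_branch w, C.center_mem_stars w⟩
    rintro rfl
    simp at hw
  · exact tendsto_of_tendsto_of_tendsto_of_le_of_le tendsto_const_nhds
      (tendsto_subtype_ediam hC.tendsto_diam_branch k) (fun _ => zero_le)
      (fun w => Metric.ediam_mono inter_subset_left)

theorem exists_lt_length_ediam_lt (hC : C.IsAdmissible) {ε : ENNReal} (hε : 0 < ε) :
    ∃ k, ∀ w : Address, k ≤ w.length → Metric.ediam (C.branch w) < ε := by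
  have hfin : {v : Address | ¬ Metric.ediam (C.branch v) < ε}.Finite :=
    hC.tendsto_diam_branch.eventually (gt_mem_nhds hε)
  obtain ⟨N, hN⟩ := (hfin.image List.length).bddAbove
  refine ⟨N + 1, fun w hw => ?_⟩
  by_contra h
  have := hN (mem_image_of_mem _ h)
  omega

theorem exists_tendsto_itineraryMap (hC : C.IsAdmissible) {x : Plane} (hx : x ∈ C.Dinf) :
    ∃ y, Tendsto C.itineraryMap (𝓝[C.stars] x) (𝓝 y) := by
  by_cases hxs : x ∈ C.stars
  · exact ⟨_, hC.continuousOn_stars x hxs⟩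
  have : (𝓝[C.stars] x).NeBot := mem_closure_iff_nhdsWithin_neBot.1 hx
  refine CompleteSpace.complete (f := map C.itineraryMap (𝓝[C.stars] x)) ?_
  rw [EMetric.cauchy_iff]
  refine ⟨(this.map _).ne, fun ε hε => ?_⟩
  obtain ⟨k, hk⟩ := hC.exists_lt_length_ediam_lt hε
  -- The summand 2 provides the length needed to send branches into branches, and absorbs the one
  -- letter that `shiftAddress` may remove.
  rcases hC.mem_D_or_mem_branch_of_mem_Dinf (k := k + 2) (by omega) hx with h | ⟨w, hw, h⟩
  · exact absurd (C.D_subset_stars _ h) hxs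
  have h1 := hC.eventually_mem_branch (w := w) (by rintro rfl; simp at hw) h
    fun h => hxs (C.D_subset_stars _ h)
  refine ⟨C.itineraryMap '' {y | y ∈ C.stars ∧ y ∈ C.branch w}, image_mem_map ?_, ?_⟩
  · filter_upwards [mem_nhdsWithin_of_mem_nhds h1, self_mem_nhdsWithin] with y hy hy'
    exact ⟨hy', hy hy'⟩
  · rintro _ ⟨y, ⟨hy, hyw⟩, rfl⟩ _ ⟨z, ⟨hz, hzw⟩, rfl⟩
    refine (Metric.edist_le_ediam_of_mem (hC.itineraryMap_mem_branch (by omega) hy hyw)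
      (hC.itineraryMap_mem_branch (by omega) hz hzw)).trans_lt (hk _ ?_)
    have := length_le_shiftAddress w
    omega

theorem existsUnique_map (hC : C.IsAdmissible) :
    ∃! f : C.Dinf → C.Dinf, Continuous f ∧ C.ActsOnItineraries f := by
  have hcont := continuousOn_extendFrom (f := C.itineraryMap) (A := C.stars) (B := C.Dinf)
    subset_rfl fun x hx => hC.exists_tendsto_itineraryMap hx
  have heq : ∀ x ∈ C.stars, extendFrom C.stars C.itineraryMap x = C.itineraryMap x :=
    fun x hx => extendFrom_eq (subset_closure hx) (hC.continuousOn_stars x hx)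
  have hmaps : MapsTo (extendFrom C.stars C.itineraryMap) C.Dinf C.Dinf := by
    intro x hx
    have hx' : x ∈ closure C.stars := hx
    have : (𝓝[C.stars] x).NeBot := mem_closure_iff_nhdsWithin_neBot.1 hx
    refine C.isClosed_Dinf.mem_of_tendsto
      (tendsto_extendFrom (hC.exists_tendsto_itineraryMap hx)) ?_
    filter_upwards [self_mem_nhdsWithin] with y hy
    exact C.stars_subset_Dinf (hC.itineraryMap_mem_stars hy)
  refine ⟨hmaps.restrict, ⟨hcont.mapsToRestrict hmaps, ?_⟩, ?_⟩
  · refine (C.actsOnItineraries_iff _).2 ⟨fun x hx => ?_, fun w n r hr x hx => ?_⟩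
    · rw [MapsTo.val_restrict_apply, hx, heq 0 (C.center_nil ▸ C.center_mem_stars []),
        hC.itineraryMap_zero]
    · rw [MapsTo.val_restrict_apply, hx, heq _ (C.point_mem_stars w n (Ioc_subset_Icc_self hr)),
        hC.itineraryMap_point w n hr]
  · rintro f ⟨hf, hact⟩
    have hact' := (C.actsOnItineraries_iff f).1 hact
    have hdense : Dense {x : C.Dinf | (x : Plane) ∈ C.stars} := by
      rw [Subtype.dense_iff]
      intro x hx
      refine closure_mono ?_ (show x ∈ closure C.stars from hx)
      intro y hy
      exact ⟨⟨y, C.stars_subset_Dinf hy⟩, hy, rfl⟩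
    refine Continuous.ext_on hdense hf (hcont.mapsToRestrict hmaps) fun x hx => ?_
    apply Subtype.ext
    rw [MapsTo.val_restrict_apply, heq _ hx]
    rcases C.exists_point_of_mem_stars hx with h | ⟨v, n, r, hr, h⟩
    · rw [hact'.1 x h, h, hC.itineraryMap_zero]
    · rw [hact'.2 v n r hr x h, h, hC.itineraryMap_point v n hr]

end IsAdmissible

end StarSystem

/-! ### An admissible system in the complex plane -/

namespace Dyadic

theorem pow_exp_le_val (a : Dyadic) : (1 / 2 : ℝ) ^ a.exp ≤ a.val := by
  have h : (1 : ℝ) ≤ a.num := by exact_mod_cast a.odd_num.pos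
  rw [one_div, inv_pow, val, div_eq_mul_inv]
  exact le_mul_of_one_le_left (by positivity) h

/-- Uses `1 ≤ a.exp`. A cone of size of order `(1 / 8) ^ a.exp` is thus small against both the
distance of `a` from 0 and its distance from dyadics of no larger exponent. -/
theorem four_mul_pow_exp_le (a : Dyadic) : 4 * (1 / 8 : ℝ) ^ a.exp ≤ (1 / 2 : ℝ) ^ a.exp := by
  have h1 : (1 / 4 : ℝ) ^ a.exp ≤ 1 / 4 := by
    simpa using pow_le_pow_of_le_one (by norm_num) (by norm_num : (1 / 4 : ℝ) ≤ 1) a.exp_pos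
  have h2 : (1 / 8 : ℝ) ^ a.exp = (1 / 2 : ℝ) ^ a.exp * (1 / 4) ^ a.exp := by
    rw [← mul_pow]; norm_num
  have h3 : (0 : ℝ) < (1 / 2 : ℝ) ^ a.exp := by positivity
  rw [h2]
  nlinarith

end Dyadic

namespace Model

/-- The truncated cone that contains the model of all stars but the first one. -/
def cone : Set ℂ := {z | |z.re| ≤ z.im ∧ z.im ≤ 1}

theorem zero_mem_cone : (0 : ℂ) ∈ cone := by simp [cone]

theorem eq_zero_of_mem_cone {z : ℂ} (hz : z ∈ cone) (h : z.im = 0) : z = 0 := by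
  have h1 := hz.1
  rw [h] at h1
  exact Complex.ext (abs_nonpos_iff.1 h1) h

theorem norm_le_of_mem_cone {z : ℂ} (hz : z ∈ cone) : ‖z‖ ≤ 2 := by
  have h1 := Complex.norm_le_abs_re_add_abs_im z
  have h2 := (abs_nonneg _).trans hz.1
  rw [abs_of_nonneg h2] at h1
  linarith [hz.1, hz.2]

theorem isCompact_cone : IsCompact cone := by
  refine Metric.isCompact_of_isClosed_isBounded ?_ ?_
  · exact (isClosed_le (continuous_abs.comp Complex.continuous_re) Complex.continuous_im).inter
      (isClosed_le Complex.continuous_im continuous_const)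
  · exact (Metric.isBounded_closedBall (x := (0 : ℂ)) (r := 2)).subset fun z hz => by
      simpa using norm_le_of_mem_cone hz

/-- The tips of the beams of the first star. -/
noncomputable def rootTip : ℕ → ℂ
  | 0 => ⟨-1, 0⟩
  | 1 => ⟨0, 1⟩
  | n + 2 => ⟨(1 / 2) ^ (n + 2), (1 / 2) ^ (n + 2) * (1 / 2) ^ (n + 2)⟩

/-- The thin sector about the positive real axis that, multiplied by `rootTip n`, contains everything that is
attached to the beam `n`. -/
def sector (n : ℕ) : Set ℂ := {z | 0 < z.re ∧ 0 ≤ z.im ∧ z.im ≤ (1 / 2) ^ n / 4 * z.re}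

/-- Pairwise disjoint regions that contain the beams of the first star without its centre. -/
def region : ℕ → Set ℂ
  | 0 => {z | z.re < 0 ∧ z.im ≤ 0}
  | 1 => {z | 0 < z.im ∧ z.re ≤ 0}
  | n + 2 => {z | 0 < z.re ∧ (1 / 2) ^ (n + 2) * z.re ≤ z.im ∧ z.im < 2 * (1 / 2) ^ (n + 2) * z.re}

theorem half_pow_le (n : ℕ) : (1 / 2 : ℝ) ^ (n + 2) ≤ 1 / 4 := by
  have := pow_le_pow_of_le_one (by norm_num) (by norm_num : (1 / 2 : ℝ) ≤ 1)
    (show 2 ≤ n + 2 by omega)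
  norm_num at this ⊢
  exact this

theorem region_disjoint_of_lt {m n : ℕ} (h : m < n) {z : ℂ} (hm : z ∈ region m)
    (hn : z ∈ region n) : False := by
  match m, n, h with
  | 0, 1, _ => exact absurd hn.1 (not_lt.2 hm.2)
  | 0, n + 2, _ => exact absurd hn.1 (not_lt.2 hm.1.le)
  | 1, n + 2, _ => exact absurd hn.1 (not_lt.2 hm.2)
  | m + 2, n + 2, h =>
    obtain ⟨h1, h2, h3⟩ := hm
    obtain ⟨_, h4, h5⟩ := hn
    have h6 : 2 * (1 / 2 : ℝ) ^ (n + 2) ≤ (1 / 2) ^ (m + 2) := by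
      have := pow_le_pow_of_le_one (by norm_num) (by norm_num : (1 / 2 : ℝ) ≤ 1)
        (show m + 3 ≤ n + 2 by omega)
      rw [pow_succ _ (m + 2)] at this
      linarith
    nlinarith

theorem region_disjoint {m n : ℕ} (h : m ≠ n) {z : ℂ} (hm : z ∈ region m) :
    z ∉ region n := fun hn =>
  h.lt_or_gt.elim (fun h => region_disjoint_of_lt h hm hn) (fun h => region_disjoint_of_lt h hn hm)

theorem rootTip_mul_mem_region {n : ℕ} {z : ℂ} (hz : z ∈ sector n) :
    rootTip n * z ∈ region n := by
  obtain ⟨h1, h2, h3⟩ := hz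
  match n, h3 with
  | 0, h3 =>
    constructor <;> simp [rootTip, Complex.mul_re, Complex.mul_im] <;> assumption
  | 1, h3 =>
    constructor <;> simp [rootTip, Complex.mul_re, Complex.mul_im] <;> assumption
  | n + 2, h3 =>
    simp only [rootTip, region, mem_ofPred_eq, Complex.mul_re, Complex.mul_im]
    have hd := half_pow_le n
    have hd0 : (0 : ℝ) < (1 / 2) ^ (n + 2) := by positivity
    generalize (1 / 2 : ℝ) ^ (n + 2) = d at *
    generalize z.re = u at *
    generalize z.im = v at *
    have h4 : d * v ≤ u / 64 := by nlinarith
    have h5 : 0 ≤ d * v := by positivity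
    have h6 : 0 ≤ d * (d * v) := by positivity
    have h7 : d * (d * v) ≤ d * (u / 64) := mul_le_mul_of_nonneg_left h4 hd0.le
    have h8 : 0 < d * u := by positivity
    refine ⟨?_, ?_, ?_⟩
    · nlinarith
    · nlinarith
    -- This is the goal divided by `d`. It holds since `v ≤ d * u / 4` and `d * (d * v) ≤ d * u /
    -- 64`.
    · have : v + 2 * (d * (d * v)) < d * u := by nlinarith
      nlinarith

/-- Beams of index at least 2 and their attachments have slopes below 1, so a quarter turn moves
them into the cone. This is why the later stars are modelled on these beams only. -/
theorem I_mul_rootTip_mul_mem_cone {n : ℕ} {z : ℂ} (hz : z ∈ sector (n + 2)) (hz' : z.re ≤ 2) :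
    Complex.I * (rootTip (n + 2) * z) ∈ cone := by
  have h := rootTip_mul_mem_region hz
  obtain ⟨h1, h2, h3⟩ := hz
  have hre : (rootTip (n + 2) * z).re ≤ 1 := by
    simp only [rootTip, Complex.mul_re]
    have hd := half_pow_le n
    have hd0 : (0 : ℝ) < (1 / 2) ^ (n + 2) := by positivity
    generalize (1 / 2 : ℝ) ^ (n + 2) = d at *
    have : 0 ≤ d * d * z.im := by positivity
    nlinarith
  obtain ⟨h4, h5, h6⟩ := h
  have hd := half_pow_le n
  have hd0 : (0 : ℝ) < (1 / 2) ^ (n + 2) := by positivity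
  generalize (1 / 2 : ℝ) ^ (n + 2) = d at *
  refine ⟨?_, ?_⟩
  · simp only [Complex.I_mul_re, Complex.I_mul_im, abs_neg]
    rw [abs_of_nonneg (by nlinarith)]
    nlinarith
  · simpa using hre

/-- The scaling factor of the branch that is attached to the beam `n` at the proportion `a`. -/
noncomputable def size (n : ℕ) (a : Dyadic) : ℝ := (1 / 2) ^ n / 4 * (1 / 8) ^ a.exp

theorem size_pos (n : ℕ) (a : Dyadic) : 0 < size n a := by unfold size; positivity

theorem size_le (n : ℕ) (a : Dyadic) : size n a ≤ (1 / 8) ^ a.exp / 4 := by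
  have h1 : (1 / 2 : ℝ) ^ n ≤ 1 := pow_le_one₀ (by norm_num) (by norm_num)
  have h2 : (0 : ℝ) < (1 / 8) ^ a.exp := by positivity
  unfold size
  nlinarith

theorem real_mem_sector (n : ℕ) {r : ℝ} (hr : 0 < r) : (r : ℂ) ∈ sector n := by
  refine ⟨by simpa using hr, by simp, ?_⟩
  simp only [Complex.ofReal_im, Complex.ofReal_re]
  positivity

/-- The position, relative to the beam, of a point of a branch. -/
noncomputable def place (n : ℕ) (a : Dyadic) (z : ℂ) : ℂ := a.val + size n a * z

theorem place_re (n : ℕ) (a : Dyadic) (z : ℂ) : (place n a z).re = a.val + size n a * z.re := by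
  simp [place]

theorem place_im (n : ℕ) (a : Dyadic) (z : ℂ) : (place n a z).im = size n a * z.im := by
  simp [place]

theorem place_mem_sector (n : ℕ) (a : Dyadic) {z : ℂ} (hz : z ∈ cone) :
    place n a z ∈ sector n := by
  have h0 := (abs_nonneg _).trans hz.1
  have h1 := neg_le_of_abs_le (hz.1.trans hz.2)
  have h2 := hz.2
  have h3 := size_pos n a
  have h4 := size_le n a
  have h5 := a.pow_exp_le_val
  have h6 := a.four_mul_pow_exp_le
  have h7 : (0 : ℝ) < (1 / 8) ^ a.exp := by positivity
  have h8 : (1 / 8) ^ a.exp ≤ a.val + size n a * z.re := by nlinarith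
  refine ⟨?_, ?_, ?_⟩
  · rw [place_re]; linarith
  · rw [place_im]; positivity
  · rw [place_re, place_im]
    calc size n a * z.im ≤ size n a * 1 := mul_le_mul_of_nonneg_left h2 h3.le
      _ = (1 / 2) ^ n / 4 * (1 / 8) ^ a.exp := mul_one _
      _ ≤ _ := mul_le_mul_of_nonneg_left h8 (by positivity)

theorem place_re_le (n : ℕ) (a : Dyadic) {z : ℂ} (hz : z ∈ cone) : (place n a z).re ≤ 2 := by
  have h1 := le_of_abs_le (hz.1.trans hz.2)
  have h3 := size_pos n a
  have h4 := size_le n a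
  have h5 : (1 / 8 : ℝ) ^ a.exp ≤ 1 := pow_le_one₀ (by norm_num) (by norm_num)
  have h6 := a.val_lt_one
  rw [place_re]
  nlinarith

/-- Two upright cones on the real line that share a point of height `h` have apexes at most `2 * h`
apart. This height is at most the size of the cone at `b`, however large the one at `a` is, whereas
the apexes are at least `(1 / 2) ^ b.exp` apart. -/
theorem place_ne_of_exp_le {n : ℕ} {a b : Dyadic} (hab : a ≠ b) (h : a.exp ≤ b.exp) {z z' : ℂ}
    (hz : z ∈ cone) (hz' : z' ∈ cone) : place n a z ≠ place n b z' := by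
  intro heq
  have h1 := congrArg Complex.re heq
  have h2 := congrArg Complex.im heq
  rw [place_re, place_re] at h1
  rw [place_im, place_im] at h2
  have h3 := Dyadic.one_le_abs_sub_mul a b hab h
  have h4 := size_pos n a
  have h5 := size_pos n b
  have h6 := size_le n b
  have h7 : |a.val - b.val| ≤ 2 * size n b := by
    have e1 : a.val - b.val = size n b * z'.re - size n a * z.re := by linarith
    rw [e1]
    calc |size n b * z'.re - size n a * z.re|
        ≤ |size n b * z'.re| + |size n a * z.re| := abs_sub _ _
      _ = size n b * |z'.re| + size n a * |z.re| := by
        rw [abs_mul, abs_mul, abs_of_pos h4, abs_of_pos h5]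
      _ ≤ size n b * z'.im + size n a * z.im :=
        add_le_add (mul_le_mul_of_nonneg_left hz'.1 h5.le) (mul_le_mul_of_nonneg_left hz.1 h4.le)
      _ = 2 * (size n b * z'.im) := by rw [h2]; ring
      _ ≤ 2 * size n b := by nlinarith [hz'.2]
  have h8 := b.four_mul_pow_exp_le
  have h9 : (1 / 2 : ℝ) ^ b.exp * 2 ^ b.exp = 1 := by rw [← mul_pow]; norm_num
  have h10 : (0 : ℝ) < 2 ^ b.exp := by positivity
  have h11 : |a.val - b.val| ≤ (1 / 2 : ℝ) ^ b.exp / 8 := by linarith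
  nlinarith

theorem place_ne {n : ℕ} {a b : Dyadic} (hab : a ≠ b) {z z' : ℂ}
    (hz : z ∈ cone) (hz' : z' ∈ cone) : place n a z ≠ place n b z' :=
  (le_total a.exp b.exp).elim (fun h => place_ne_of_exp_le hab h hz hz')
    (fun h => (place_ne_of_exp_le hab.symm h hz' hz).symm)

theorem rootTip_ne_zero (n : ℕ) : rootTip n ≠ 0 := by
  intro h
  match n, h with
  | 0, h => simpa [rootTip] using congrArg Complex.re h
  | 1, h => simpa [rootTip] using congrArg Complex.im h
  | n + 2, h => simpa [rootTip] using congrArg Complex.re h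

theorem norm_rootTip_le (n : ℕ) : ‖rootTip n‖ ≤ 2 * (1 / 2) ^ n := by
  refine (Complex.norm_le_abs_re_add_abs_im _).trans ?_
  match n with
  | 0 => norm_num [rootTip]
  | 1 => norm_num [rootTip]
  | n + 2 =>
    have hd := half_pow_le n
    have hd0 : (0 : ℝ) < (1 / 2) ^ (n + 2) := by positivity
    simp only [rootTip]
    generalize (1 / 2 : ℝ) ^ (n + 2) = d at *
    rw [abs_of_pos hd0, abs_of_pos (by positivity)]
    nlinarith

/-! ### Similarities attached to letters and addresses -/

/-- The beam of the first star that serves as a model for the beam `n`, of the first star if `b = true` and of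
the model of all other stars if `b = false`. -/
def index : Bool → ℕ → ℕ
  | true, n => n
  | false, n => n + 2

/-- The rotation applied to the model beams. -/
noncomputable def rotation : Bool → ℂ
  | true => 1
  | false => Complex.I

/-- The tips of the beams of the first star (`b = true`) and of the model of all other stars (`b = false`). -/
noncomputable def modelTip (b : Bool) (n : ℕ) : ℂ := rotation b * rootTip (index b n)

/-- The similarity that moves the model of a branch to the point of proportion `p.2` of the beam `p.1`. -/
noncomputable def step (b : Bool) (p : ℕ × Dyadic) (z : ℂ) : ℂ :=
  modelTip b p.1 * place (index b p.1) p.2 z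

theorem rotation_ne_zero (b : Bool) : rotation b ≠ 0 := by
  cases b <;> simp [rotation]

theorem norm_rotation (b : Bool) : ‖rotation b‖ = 1 := by
  cases b <;> simp [rotation]

theorem index_injective (b : Bool) : Function.Injective (index b) := by
  intro m n h
  cases b <;> simpa [index] using h

theorem le_index (b : Bool) (n : ℕ) : n ≤ index b n := by cases b <;> simp [index]

theorem modelTip_ne_zero (b : Bool) (n : ℕ) : modelTip b n ≠ 0 :=
  mul_ne_zero (rotation_ne_zero b) (rootTip_ne_zero _)

theorem norm_modelTip_le (b : Bool) (n : ℕ) : ‖modelTip b n‖ ≤ 2 * (1 / 2) ^ n := by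
  rw [modelTip, norm_mul, norm_rotation, one_mul]
  refine (norm_rootTip_le _).trans ?_
  have := pow_le_pow_of_le_one (by norm_num) (by norm_num : (1 / 2 : ℝ) ≤ 1) (le_index b n)
  linarith

theorem modelTip_mul_ne (b : Bool) {m n : ℕ} (h : m ≠ n) {z z' : ℂ}
    (hz : z ∈ sector (index b m)) (hz' : z' ∈ sector (index b n)) :
    modelTip b m * z ≠ modelTip b n * z' := by
  rw [modelTip, modelTip, mul_assoc, mul_assoc]
  intro heq
  have h1 := mul_left_cancel₀ (rotation_ne_zero b) heq
  refine region_disjoint ((index_injective b).ne h) (rootTip_mul_mem_region hz) ?_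
  rw [h1]
  exact rootTip_mul_mem_region hz'

theorem place_ne_zero (n : ℕ) (a : Dyadic) {z : ℂ} (hz : z ∈ cone) : place n a z ≠ 0 := by
  intro h
  have := (place_mem_sector n a hz).1
  rw [h] at this
  simp at this

theorem step_ne_zero (b : Bool) (p : ℕ × Dyadic) {z : ℂ} (hz : z ∈ cone) : step b p z ≠ 0 :=
  mul_ne_zero (modelTip_ne_zero b _) (place_ne_zero _ _ hz)

theorem step_injective (b : Bool) (p : ℕ × Dyadic) : Function.Injective (step b p) := by
  intro z z' h
  have h1 := mul_left_cancel₀ (modelTip_ne_zero b p.1) h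
  have h2 := add_left_cancel h1
  exact mul_left_cancel₀ (by exact_mod_cast (size_pos _ _).ne') h2

theorem continuous_step (b : Bool) (p : ℕ × Dyadic) : Continuous (step b p) := by
  unfold step place
  fun_prop

theorem step_mem_cone (p : ℕ × Dyadic) {z : ℂ} (hz : z ∈ cone) : step false p z ∈ cone := by
  rw [step, modelTip, mul_assoc]
  exact I_mul_rootTip_mul_mem_cone (place_mem_sector _ _ hz) (place_re_le _ _ hz)

theorem modelTip_mul_mem_cone (n : ℕ) {r : ℝ} (hr : r ∈ Icc (0 : ℝ) 1) :
    modelTip false n * r ∈ cone := by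
  rcases hr.1.eq_or_lt with h | h
  · simpa [← h] using zero_mem_cone
  · rw [modelTip, mul_assoc]
    refine I_mul_rootTip_mul_mem_cone (real_mem_sector _ h) ?_
    rw [Complex.ofReal_re]
    linarith [hr.2]

theorem step_ne (b : Bool) {p q : ℕ × Dyadic} (h : p ≠ q) {z z' : ℂ} (hz : z ∈ cone)
    (hz' : z' ∈ cone) : step b p z ≠ step b q z' := by
  obtain ⟨m, a⟩ := p
  obtain ⟨n, c⟩ := q
  by_cases hmn : m = n
  · subst hmn
    intro heq
    exact place_ne (fun hac : a = c => h (by rw [hac])) hz hz'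
      (mul_left_cancel₀ (modelTip_ne_zero b m) heq)
  · exact modelTip_mul_ne b hmn (place_mem_sector _ _ hz) (place_mem_sector _ _ hz')

/-- Relative to its own beam, an attached cone touches the real axis at the apex only; from the
other beams it is separated by the regions. -/
theorem eq_zero_of_step_eq (b : Bool) {p : ℕ × Dyadic} {n : ℕ} {r : ℝ} {z : ℂ} (hz : z ∈ cone)
    (hr : 0 ≤ r) (h : step b p z = modelTip b n * r) : z = 0 := by
  rcases hr.eq_or_lt with h0 | h0
  · rw [← h0] at h
    exact absurd (by simpa using h) (step_ne_zero b p hz)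
  · by_cases hpn : p.1 = n
    · rw [step, hpn] at h
      have h1 := congrArg Complex.im (mul_left_cancel₀ (modelTip_ne_zero b n) h)
      rw [place_im, Complex.ofReal_im] at h1
      exact eq_zero_of_mem_cone hz ((mul_eq_zero.1 h1).resolve_left (size_pos _ _).ne')
    · exact absurd h (modelTip_mul_ne b hpn (place_mem_sector _ _ hz) (real_mem_sector _ h0))

theorem eq_zero_of_modelTip_mul_eq (b : Bool) {m n : ℕ} (hmn : m ≠ n) {r s : ℝ}
    (hr : 0 ≤ r) (hs : 0 ≤ s) (h : modelTip b m * r = modelTip b n * s) : r = 0 := by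
  rcases hr.eq_or_lt with hr' | hr'
  · exact hr'.symm
  rcases hs.eq_or_lt with hs' | hs'
  · rw [← hs'] at h
    simpa [modelTip_ne_zero] using h
  · exact absurd h (modelTip_mul_ne b hmn (real_mem_sector _ hr') (real_mem_sector _ hs'))

/-- A bound for the contraction ratio of `step`. -/
noncomputable def ratio (p : ℕ × Dyadic) : ℝ := (1 / 2) ^ p.1 * (1 / 8) ^ p.2.exp

theorem norm_step_sub_le (b : Bool) (p : ℕ × Dyadic) (z z' : ℂ) :
    ‖step b p z - step b p z'‖ ≤ ratio p * ‖z - z'‖ := by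
  have h1 : step b p z - step b p z'
      = modelTip b p.1 * (size (index b p.1) p.2 * (z - z')) := by
    simp only [step, place]; ring
  have h2 := norm_modelTip_le b p.1
  have h3 : (1 / 2 : ℝ) ^ p.1 ≤ 1 := pow_le_one₀ (by norm_num) (by norm_num)
  have h4 := pow_le_pow_of_le_one (by norm_num) (by norm_num : (1 / 2 : ℝ) ≤ 1) (le_index b p.1)
  have h5 : size (index b p.1) p.2 ≤ ratio p / 4 := by
    unfold size ratio
    have : (0 : ℝ) < (1 / 8) ^ p.2.exp := by positivity
    nlinarith
  have h6 : ‖modelTip b p.1‖ ≤ 2 := by linarith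
  have h7 := size_pos (index b p.1) p.2
  rw [h1, norm_mul, norm_mul, Complex.norm_real, Real.norm_of_nonneg h7.le, ← mul_assoc]
  refine mul_le_mul_of_nonneg_right ?_ (norm_nonneg _)
  nlinarith [norm_nonneg (modelTip b p.1)]

/-- The similarity that moves the model of a branch to the branch at an address. -/
noncomputable def move : Bool → Address → ℂ → ℂ
  | _, [], z => z
  | b, p :: w, z => step b p (move false w z)

/-- The point with the itinerary `(w, n, r)`. -/
noncomputable def pt : Bool → Address → ℕ → ℝ → ℂ
  | b, [], n, r => modelTip b n * r
  | b, p :: w, n, r => step b p (pt false w n r)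

theorem continuous_move (b : Bool) (w : Address) : Continuous (move b w) := by
  induction w generalizing b with
  | nil => exact continuous_id
  | cons p w ih => exact (continuous_step b p).comp (ih false)

theorem move_append (b : Bool) (w : Address) (n : ℕ) (a : Dyadic) :
    move b (w ++ [(n, a)]) 0 = pt b w n a.val := by
  induction w generalizing b with
  | nil => simp [move, pt, step, place]
  | cons p w ih => simp only [List.cons_append, move, pt, ih]

theorem pt_zero (b : Bool) (w : Address) (n : ℕ) : pt b w n 0 = move b w 0 := by
  induction w generalizing b with
  | nil => simp [move, pt]
  | cons p w ih => simp only [move, pt, ih]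

theorem pt_eq_lineMap (b : Bool) (w : Address) (n : ℕ) (r : ℝ) :
    pt b w n r = move b w 0 + r * (pt b w n 1 - move b w 0) := by
  induction w generalizing b with
  | nil => simp [move, pt]; ring
  | cons p w ih =>
    simp only [move, pt]
    rw [ih false]
    simp only [step, place]
    ring

theorem pt_false_append (w u : Address) (n : ℕ) (r : ℝ) :
    pt false (w ++ u) n r = move false w (pt false u n r) := by
  induction w with
  | nil => rfl
  | cons p w ih => simp only [List.cons_append, pt, move, ih]

/-- After one letter all stars follow the model `false`; for `w = []` and `b = true` the two sides
would use different models. -/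
theorem pt_append (b : Bool) {w : Address} (hw : w ≠ []) (u : Address) (n : ℕ) (r : ℝ) :
    pt b (w ++ u) n r = move b w (pt false u n r) := by
  match w, hw with
  | p :: w, _ => simp only [List.cons_append, pt, move, pt_false_append]

theorem move_mem_cone (w : Address) {z : ℂ} (hz : z ∈ cone) : move false w z ∈ cone := by
  induction w with
  | nil => exact hz
  | cons p w ih => exact step_mem_cone p ih

theorem pt_mem_cone (w : Address) (n : ℕ) {r : ℝ} (hr : r ∈ Icc (0 : ℝ) 1) :
    pt false w n r ∈ cone := by
  induction w with
  | nil => exact modelTip_mul_mem_cone n hr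
  | cons p w ih => exact step_mem_cone p ih

/-- Common first letters cancel by injectivity. At the first difference `step_ne` separates the
copies of the cone. -/
theorem move_ne (b : Bool) {v w : Address} (hl : v.length = w.length) (h : v ≠ w) {z z' : ℂ}
    (hz : z ∈ cone) (hz' : z' ∈ cone) : move b v z ≠ move b w z' := by
  induction v generalizing b w with
  | nil => exact absurd (List.length_eq_zero_iff.1 hl.symm).symm h
  | cons p v ih =>
    match w, hl with
    | q :: w, hl =>
      simp only [move]
      by_cases hpq : p = q
      · subst hpq
        exact (step_injective b p).ne (ih false (by simpa using hl) fun h' => h (by rw [h']))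
      · exact step_ne b hpq (move_mem_cone v hz) (move_mem_cone w hz')

theorem eq_zero_of_move_eq (b : Bool) {v w : Address} (hl : v.length < w.length) {n : ℕ} {r : ℝ}
    {z : ℂ} (hz : z ∈ cone) (hr : r ∈ Icc (0 : ℝ) 1) (h : move b w z = pt b v n r) : z = 0 := by
  induction w generalizing b v with
  | nil => simp at hl
  | cons p w ih =>
    match v, hl with
    | [], _ =>
      have h1 := eq_zero_of_step_eq b (move_mem_cone w hz) hr.1 h
      -- The rest of the address moves `z` to the apex. A further letter would keep it away from 0,
      -- so no letter is left.
      match w, h1 with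
      | [], h1 => exact h1
      | q :: w, h1 => exact absurd h1 (step_ne_zero false q (move_mem_cone w hz))
    | q :: v, hl =>
      simp only [move, pt] at h
      by_cases hpq : p = q
      · subst hpq
        exact ih false (by simpa using hl) (step_injective b p h)
      · exact absurd h (step_ne b hpq (move_mem_cone w hz) (pt_mem_cone v n hr))

theorem eq_zero_of_pt_eq (b : Bool) (w : Address) {m n : ℕ} (hmn : m ≠ n) {r s : ℝ}
    (hr : 0 ≤ r) (hs : 0 ≤ s) (h : pt b w m r = pt b w n s) : r = 0 := by
  induction w generalizing b with
  | nil => exact eq_zero_of_modelTip_mul_eq b hmn hr hs h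
  | cons p w ih => exact ih false (step_injective b p h)

theorem pt_injective (b : Bool) (w : Address) (n : ℕ) : Function.Injective (pt b w n) := by
  induction w generalizing b with
  | nil =>
    intro r s h
    exact_mod_cast mul_left_cancel₀ (modelTip_ne_zero b n) h
  | cons p w ih => exact (step_injective b p).comp (ih false)

/-! ### Contraction ratios and smallness of the branches -/

theorem ratio_pos (p : ℕ × Dyadic) : 0 < ratio p := by unfold ratio; positivity

theorem ratio_le_left (p : ℕ × Dyadic) : ratio p ≤ (1 / 2) ^ p.1 :=
  mul_le_of_le_one_right (by positivity) (pow_le_one₀ (by norm_num) (by norm_num))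

theorem ratio_le_right (p : ℕ × Dyadic) : ratio p ≤ (1 / 2) ^ p.2.exp := by
  refine (mul_le_of_le_one_left (by positivity) (pow_le_one₀ (by norm_num) (by norm_num))).trans ?_
  exact pow_le_pow_left₀ (by norm_num) (by norm_num) _

theorem ratio_le_half (p : ℕ × Dyadic) : ratio p ≤ 1 / 2 := by
  refine (ratio_le_right p).trans ?_
  simpa using pow_le_pow_of_le_one (by norm_num) (by norm_num : (1 / 2 : ℝ) ≤ 1) p.2.exp_pos

theorem norm_pt_sub_le (b : Bool) (w : Address) (n : ℕ) :
    ‖pt b w n 1 - pt b w n 0‖ ≤ 2 * (1 / 2) ^ n := by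
  induction w generalizing b with
  | nil => simpa [pt] using norm_modelTip_le b n
  | cons p w ih =>
    refine (norm_step_sub_le b p _ _).trans ?_
    nlinarith [ih false, ratio_le_half p, norm_nonneg (pt false w n 1 - pt false w n 0)]

theorem norm_move_sub_le (b : Bool) (w : Address) (z z' : ℂ) :
    ‖move b w z - move b w z'‖ ≤ (w.map ratio).prod * ‖z - z'‖ := by
  induction w generalizing b with
  | nil => simp [move]
  | cons p w ih =>
    refine (norm_step_sub_le b p _ _).trans ?_
    rw [List.map_cons, List.prod_cons, mul_assoc]
    exact mul_le_mul_of_nonneg_left (ih false) (ratio_pos p).le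

theorem finite_ratio_ge {ε : ℝ} (hε : 0 < ε) : {p : ℕ × Dyadic | ε ≤ ratio p}.Finite := by
  obtain ⟨N, hN⟩ := exists_pow_lt_of_lt_one hε (by norm_num : (1 / 2 : ℝ) < 1)
  have hN' : ∀ k, ε ≤ (1 / 2) ^ k → k ≤ N := by
    intro k hk
    by_contra hlt
    have := pow_le_pow_of_le_one (by norm_num) (by norm_num : (1 / 2 : ℝ) ≤ 1) (not_le.1 hlt).le
    linarith
  refine ((finite_Iic N).prod (Dyadic.finite_exp_le N)).subset fun p hp => ?_
  exact ⟨hN' _ (hp.trans (ratio_le_left p)), hN' _ (hp.trans (ratio_le_right p))⟩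

theorem finite_lists {α : Type*} {S : Set α} (hS : S.Finite) (N : ℕ) :
    {w : List α | w.length ≤ N ∧ ∀ p ∈ w, p ∈ S}.Finite := by
  induction N with
  | zero =>
    refine (finite_singleton []).subset fun w hw => ?_
    simpa using hw.1
  | succ N ih =>
    refine ((finite_singleton []).union (hS.image2 List.cons ih)).subset fun w hw => ?_
    match w, hw with
    | [], _ => exact .inl rfl
    | p :: w, hw =>
      refine .inr ⟨p, hw.2 p (by simp), w, ⟨by simpa using hw.1, fun q hq => hw.2 q (by simp [hq])⟩,
        rfl⟩

theorem prod_ratio_pos (w : Address) : 0 < (w.map ratio).prod := by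
  induction w with
  | nil => simp
  | cons p w ih => simpa using mul_pos (ratio_pos p) ih

theorem prod_ratio_le (w : Address) : (w.map ratio).prod ≤ (1 / 2) ^ w.length := by
  induction w with
  | nil => simp
  | cons p w ih =>
    rw [List.map_cons, List.prod_cons, List.length_cons, pow_succ']
    exact mul_le_mul (ratio_le_half p) ih (prod_ratio_pos w).le (by norm_num)

theorem prod_ratio_le_of_mem {w : Address} {p : ℕ × Dyadic} (hp : p ∈ w) :
    (w.map ratio).prod ≤ ratio p := by
  induction w with
  | nil => simp at hp
  | cons q w ih =>
    rw [List.map_cons, List.prod_cons]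
    have h1 := ratio_le_half q
    have h2 := prod_ratio_pos w
    have h3 := ratio_pos q
    rcases List.mem_cons.1 hp with rfl | hp
    · have h4 : (w.map ratio).prod ≤ 1 :=
        (prod_ratio_le w).trans (pow_le_one₀ (by norm_num) (by norm_num))
      nlinarith
    · nlinarith [ih hp]

/-- All ratios are at most `1 / 2`, so a product of at least `ε` bounds the length. It also bounds
each factor below by `ε`, which leaves finitely many letters. -/
theorem finite_prod_ratio_ge {ε : ℝ} (hε : 0 < ε) :
    {w : Address | ε ≤ (w.map ratio).prod}.Finite := by
  obtain ⟨N, hN⟩ := exists_pow_lt_of_lt_one hε (by norm_num : (1 / 2 : ℝ) < 1)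
  refine (finite_lists (finite_ratio_ge hε) N).subset fun w hw => ⟨?_, fun p hp => ?_⟩
  · by_contra hlt
    have h1 := pow_le_pow_of_le_one (by norm_num) (by norm_num : (1 / 2 : ℝ) ≤ 1) (not_le.1 hlt).le
    have h2 := hw.trans (prod_ratio_le w)
    linarith
  · exact hw.trans (prod_ratio_le_of_mem hp)

/-! ### Transfer to the Euclidean plane and admissibility -/

/-- The plane of complex numbers as the Euclidean plane. -/
noncomputable def toPlane : ℂ ≃ₗᵢ[ℝ] Plane := Complex.orthonormalBasisOneI.repr

theorem toPlane_apply_zero (z : ℂ) : toPlane z 0 = z.re := by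
  simp [toPlane]

theorem toPlane_apply_one (z : ℂ) : toPlane z 1 = z.im := by
  simp [toPlane]

theorem toPlane_pt_eq_lineMap (w : Address) (n : ℕ) (r : ℝ) :
    toPlane (pt true w n r)
      = AffineMap.lineMap (toPlane (move true w 0)) (toPlane (pt true w n 1)) r := by
  rw [pt_eq_lineMap, AffineMap.lineMap_apply, vsub_eq_sub, vadd_eq_add, map_add, ← Complex.real_smul,
    map_smul, map_sub, add_comm]

/-- An admissible system of stars. -/
noncomputable def system : StarSystem where
  center w := toPlane (move true w 0)
  tip w n := toPlane (pt true w n 1)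
  center_nil := by simp [move]
  center_append w n a := by rw [move_append, toPlane_pt_eq_lineMap]

theorem system_point (w : Address) (n : ℕ) (r : ℝ) :
    system.point w n r = toPlane (pt true w n r) := (toPlane_pt_eq_lineMap w n r).symm

/-- The cone is compact, so its copy is closed and contains the limit points of the branch too.
Statements on branches thus reduce to statements on cones. -/
theorem system_branch_subset {w : Address} (hw : w ≠ []) :
    system.branch w ⊆ toPlane '' (move true w '' cone) := by
  refine closure_minimal ?_ ?_
  · refine iUnion_subset fun u x hx => ?_
    obtain ⟨n, r, hr, rfl⟩ := system.mem_star.1 hx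
    rw [system_point, pt_append true hw]
    exact mem_image_of_mem _ (mem_image_of_mem _ (pt_mem_cone u n hr))
  · exact ((isCompact_cone.image (continuous_move true w)).image toPlane.continuous).isClosed

theorem ediam_branch_le {w : Address} (hw : w ≠ []) :
    Metric.ediam (system.branch w) ≤ ENNReal.ofReal ((w.map ratio).prod * 4) := by
  refine (Metric.ediam_mono (system_branch_subset hw)).trans ?_
  rw [toPlane.isometry.ediam_image]
  refine Metric.ediam_le ?_
  rintro _ ⟨z, hz, rfl⟩ _ ⟨z', hz', rfl⟩
  rw [edist_dist, dist_eq_norm]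
  refine ENNReal.ofReal_le_ofReal ((norm_move_sub_le true w z z').trans ?_)
  refine mul_le_mul_of_nonneg_left ((norm_sub_le _ _).trans ?_) (prod_ratio_pos w).le
  linarith [norm_le_of_mem_cone hz, norm_le_of_mem_cone hz']

theorem rootTip_add_two (n : ℕ) : system.tip [] (n + 2)
    = toPlane ⟨(1 / 2) ^ (n + 2), (1 / 2) ^ (n + 2) * (1 / 2) ^ (n + 2)⟩ := by
  simp [system, pt, modelTip, rotation, index, rootTip]

theorem slope_system (n : ℕ) : system.slope (n + 2) = (1 / 2) ^ (n + 2) := by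
  rw [StarSystem.slope, rootTip_add_two, toPlane_apply_zero, toPlane_apply_one]
  exact mul_div_cancel_left₀ _ (by positivity)

theorem system_isAdmissible : system.IsAdmissible where
  tip_ne_center w n := by
    intro h
    have h1 := toPlane.injective h
    rw [← pt_zero true w n] at h1
    exact one_ne_zero (pt_injective true w n h1)
  beam_inter_beam w m n hmn := by
    refine Subset.antisymm ?_ (singleton_subset_iff.2
      ⟨system.center_mem_beam w m, system.center_mem_beam w n⟩)
    rintro x ⟨hm, hn⟩
    rw [StarSystem.beam_eq] at hm hn
    obtain ⟨r, hr, rfl⟩ := hm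
    obtain ⟨s, hs, h⟩ := hn
    rw [system_point, system_point] at h
    have := eq_zero_of_pt_eq true w hmn hr.1 hs.1 (toPlane.injective h).symm
    rw [this, StarSystem.point_zero]
    rfl
  tendsto_diam_beam w := by
    have h1 : ∀ n, Metric.ediam (system.beam w n) ≤ ENNReal.ofReal (2 * (1 / 2) ^ n) := by
      intro n
      rw [StarSystem.beam, ← convexHull_pair, convexHull_ediam, Metric.ediam_pair, edist_comm,
        edist_dist]
      refine ENNReal.ofReal_le_ofReal ?_
      have h2 := norm_pt_sub_le true w n
      rw [pt_zero, ← dist_eq_norm, ← toPlane.dist_map] at h2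
      exact h2
    have h3 : Tendsto (fun n : ℕ => ENNReal.ofReal (2 * (1 / 2) ^ n)) atTop (𝓝 0) := by
      have := (tendsto_pow_atTop_nhds_zero_of_lt_one (by norm_num)
        (by norm_num : (1 / 2 : ℝ) < 1)).const_mul 2
      simpa using ENNReal.tendsto_ofReal this
    exact tendsto_of_tendsto_of_tendsto_of_le_of_le tendsto_const_nhds h3 (fun _ => zero_le) h1
  tip_nil_zero := by
    ext i
    fin_cases i
    · exact (toPlane_apply_zero _).trans (by simp [pt, modelTip, rotation, index, rootTip])
    · exact (toPlane_apply_one _).trans (by simp [pt, modelTip, rotation, index, rootTip])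
  tip_nil_one := by
    ext i
    fin_cases i
    · exact (toPlane_apply_zero _).trans (by simp [pt, modelTip, rotation, index, rootTip])
    · exact (toPlane_apply_one _).trans (by simp [pt, modelTip, rotation, index, rootTip])
  beam_nil_subset n hn := by
    obtain ⟨n, rfl⟩ := Nat.exists_eq_add_of_le' hn
    intro x hx
    rw [StarSystem.beam_eq] at hx
    obtain ⟨r, hr, rfl⟩ := hx
    rw [mem_ofPred_eq, system_point, toPlane_apply_zero, toPlane_apply_one]
    have := hr.1
    constructor <;> simp [pt, modelTip, rotation, index, rootTip] <;> positivity
  slope_pos n hn := by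
    obtain ⟨n, rfl⟩ := Nat.exists_eq_add_of_le' hn
    rw [slope_system]
    positivity
  slope_succ_lt n hn := by
    obtain ⟨n, rfl⟩ := Nat.exists_eq_add_of_le' hn
    rw [slope_system, show n + 2 + 1 = (n + 1) + 2 from rfl, slope_system]
    exact pow_lt_pow_right_of_lt_one₀ (by norm_num) (by norm_num) (by omega)
  tendsto_slope := by
    rw [← tendsto_add_atTop_iff_nat 2]
    simp only [slope_system]
    exact (tendsto_add_atTop_iff_nat 2).2
      (tendsto_pow_atTop_nhds_zero_of_lt_one (by norm_num) (by norm_num))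
  branch_inter_D w hw := by
    refine Subset.antisymm ?_ (singleton_subset_iff.2
      ⟨system.center_mem_branch w, StarSystem.IsAdmissible.center_mem_D hw⟩)
    rintro x ⟨hx, hxD⟩
    obtain ⟨_, ⟨z, hz, rfl⟩, rfl⟩ := system_branch_subset hw hx
    obtain ⟨v, hv, hxv⟩ := mem_iUnion₂.1 hxD
    obtain ⟨n, r, hr, h⟩ := system.mem_star.1 hxv
    rw [system_point] at h
    rw [eq_zero_of_move_eq true hv hz hr (toPlane.injective h)]
    rfl
  disjoint_branch v w hl hne := by
    have hv : v ≠ [] := by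
      rintro rfl
      exact hne (List.length_eq_zero_iff.1 hl.symm).symm
    have hw : w ≠ [] := by
      rintro rfl
      exact hne (List.length_eq_zero_iff.1 hl)
    refine Set.disjoint_left.2 fun x hxv hxw => ?_
    obtain ⟨_, ⟨z, hz, rfl⟩, rfl⟩ := system_branch_subset hv hxv
    obtain ⟨_, ⟨z', hz', rfl⟩, h⟩ := system_branch_subset hw hxw
    exact move_ne true hl hne hz hz' (toPlane.injective h).symm
  tendsto_diam_branch := by
    refine ENNReal.tendsto_nhds_zero.2 fun ε hε => ?_
    obtain ⟨δ, hδ, hδε⟩ := ENNReal.lt_iff_exists_real_btwn.1 hε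
    have hδ0 : 0 < δ := by simpa using hδε.1
    -- The root is set aside because only the other branches lie in a copy of the cone. The 4 is the
    -- diameter bound for the cone in `ediam_branch_le`.
    refine ((finite_singleton []).union
      (finite_prod_ratio_ge (by positivity : 0 < δ / 4))).subset fun w hw => ?_
    by_cases hnil : w = []
    · exact .inl hnil
    · refine .inr ?_
      by_contra hlt
      simp only [mem_ofPred_eq, not_le] at hlt
      refine hw ((ediam_branch_le hnil).trans (le_trans ?_ hδε.2.le))
      exact ENNReal.ofReal_le_ofReal (by linarith)

end Model

end UniversalDendrite

theorem mainTheorem7 :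
    (∃ C : UniversalDendrite.StarSystem, C.IsAdmissible) ∧
    ∀ C : UniversalDendrite.StarSystem, C.IsAdmissible →
      (∃! f : C.Dinf → C.Dinf, Continuous f ∧ C.ActsOnItineraries f) ∧
      ∀ f : C.Dinf → C.Dinf, Continuous f → C.ActsOnItineraries f →
        UniversalDendrite.IsTransitiveMap f := by
  exact ⟨⟨_, UniversalDendrite.Model.system_isAdmissible⟩, fun C hC =>
    ⟨hC.existsUnique_map, fun f _ hf => hC.isTransitiveMap hf⟩⟩
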